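/- Let $Q$ be a smooth finite-dimensional manifold and $i_N:N\hookrightarrow Q$ a smooth embedding of a smooth manifold $N$. For a manifold $M$ let $\omega_M=\mathrm{d}p_i\wedge \mathrm{d}q^i$ be the canonical symplectic form of $T^*M$; $\tau$ and $\pi$ denote tangent and cotangent bundle projections. A Lagrangian submanifold of $(P,\Omega)$ is an embedded submanifold $S\subseteq P$ with $T_xS=(T_xS)^{\Omega}$ for all $x\in S$. Let $R_d:U\to Q\times Q$, $R_d=(R^1,R^2)$, be a discretization map: $U\subseteq TQ$ is an open neighbourhood of the zero section, $R_d$ is smooth, $R_d(0_x)=(x,x)$, and $T_{0_x}(R^2|_{T_xQ})-T_{0_x}(R^1|_{T_xQ})=\mathrm{Id}_{T_xQ}$ for all $x\in Q$. Let $h>0$, put $R^h_d(v)=R_d(hv)$, and let $D\subseteq\{v\in TQ: hv\in U\}$ be any open set on which $R^h_d$ is a diffeomorphism onto its (open) image; all constructions below use $R_d^h$ as a map $D\to R_d^h(D)$. Let $\tilde L:TQ\to\mathbb R$ be any smooth function (an extension of the Lagrangian $L=\tilde L|_{TN}$ of $N$). Define $$\mathcal T^{R^h_d}N=\{v\in D: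 R^h_d(v)\in i_N(N)\times i_N(N)\},$$ $$\Sigma^d_{\tilde L}=\{\mu\in T^*TQ:\ \pi_{TQ}(\mu)\in\mathcal T^{R^h_d}N,\ \mu-\mathrm d\tilde L\in (T\,\mathcal T^{R^h_d}N)^0\},\qquad \tilde S_d=\alpha_Q^{-1}(\Sigma^d_{\tilde L})\subseteq TT^*Q,$$ where $(\cdot)^0$ is the annihilator and $\alpha_Q:TT^*Q\to T^*TQ$, $\alpha_Q(q,p,\dot q,\dot p)=(q,\dot q,\dot p,p)$, is Tulczyjew's isomorphism. Let $(R^h_d)^{T^*}=\Phi^{-1}\circ\widehat{R^h_d}\circ\alpha_Q$, where $\widehat{R^h_d}=(T(R^h_d)^{-1})^*$ is the cotangent lift and $\Phi:T^*Q\times T^*Q\to T^*(Q\times Q)$, $\Phi(q_0,p_0;q_1,p_1)=(q_0,q_1,-p_0,p_1)$. Then: 1. $(R^h_d)^{T^*}(\tilde S_d)$ is a Lagrangian submanifold of $(T^*Q\times T^*Q,\ \mathrm{pr}_2^*\omega_Q-\mathrm{pr}_1^*\omega_Q)$. 2. It projects to $N\times N$: its image under $\pi_Q\times\pi_Q$ is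 $(i_N(N)\times i_N(N))\cap R^h_d(D)$. 3. Let $i_N^*$ be the map that takes $p\in T^*_{i_N(x)}Q$ to $p\circ T_xi_N\in T_x^*N$. Then $S_N^d=(i_N^*\times i_N^*)\big((R^h_d)^{T^*}(\tilde S_d)\big)$ is a Lagrangian submanifold of $(T^*N\times T^*N,\ \mathrm{pr}_2^*\omega_N-\mathrm{pr}_1^*\omega_N)$. -/

import Mathlib

open scoped Manifold ContDiff Topology
open Bundle Set

section Geometry

variable {E : Type*} [NormedAddCommGroup E] [NormedSpace ℝ E]
  {H : Type*} [TopologicalSpace H]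
  {E' : Type*} [NormedAddCommGroup E'] [NormedSpace ℝ E']
  {H' : Type*} [TopologicalSpace H']

/-! ### Cotangent bundles -/

/-- The cotangent space `T*_x M`, the space of continuous linear maps `T_x M → ℝ`. -/
abbrev CotangentSpace (I : ModelWithCorners ℝ E H) {M : Type*} [TopologicalSpace M]
    [ChartedSpace H M] (x : M) : Type _ :=
  TangentSpace I x →L[ℝ] Bundle.Trivial M ℝ x

/-- The cotangent bundle `T*M`, as the bundle of homomorphisms from the tangent bundle to the
trivial line bundle. Mathlib makes it a smooth manifold modelled on `E × E*`; the chart at a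
covector `α` over `q` consists of the natural coordinates `(q^i, p_i)` induced by the preferred
chart of `M` at `q`. -/
abbrev CotangentBundle (I : ModelWithCorners ℝ E H) (M : Type*) [TopologicalSpace M]
    [ChartedSpace H M] : Type _ :=
  TotalSpace (E →L[ℝ] ℝ) (fun x : M => TangentSpace I x →L[ℝ] Bundle.Trivial M ℝ x)

/-- The model of the manifold `T*M`. -/
noncomputable abbrev cotangentModel (I : ModelWithCorners ℝ E H) :
    ModelWithCorners ℝ (E × (E →L[ℝ] ℝ)) (ModelProd H (E →L[ℝ] ℝ)) :=
  I.prod 𝓘(ℝ, E →L[ℝ] ℝ)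

/-- The differential `df(x)` of a real function, as a covector. -/
noncomputable def differential (I : ModelWithCorners ℝ E H) {M : Type*} [TopologicalSpace M]
    [ChartedSpace H M] (f : M → ℝ) (x : M) : CotangentSpace I x :=
  mfderiv I 𝓘(ℝ, ℝ) f x

/-! ### Submanifolds, two-forms, Lagrangian submanifolds -/

/-- `S` is an embedded smooth submanifold of the (boundaryless, finite-dimensional) manifold `M`:
around each of its points there is a smooth chart of `M` in which `S` is a linear slice. -/
def IsEmbeddedSubmanifold (I : ModelWithCorners ℝ E H) {M : Type*} [TopologicalSpace M]
    [ChartedSpace H M] (S : Set M) : Prop :=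
  ∀ x ∈ S, ∃ (e : OpenPartialHomeomorph M E) (V : Submodule ℝ E),
    x ∈ e.source ∧
    ContMDiffOn I 𝓘(ℝ, E) ∞ e e.source ∧
    ContMDiffOn 𝓘(ℝ, E) I ∞ e.symm e.target ∧
    ∀ y ∈ e.source, y ∈ S ↔ e y ∈ V

/-- The tangent space `T_x S ⊆ T_x M` of a submanifold `S` of `M`: the velocities at time `0` of
smooth curves of `M` that run in `S` and pass through `x` at time `0`. -/
def submanifoldTangent (I : ModelWithCorners ℝ E H) {M : Type*} [TopologicalSpace M]
    [ChartedSpace H M] (S : Set M) (x : M) : Set (TangentSpace I x) :=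
  {X : E | ∃ γ : ℝ → M, ContMDiffAt 𝓘(ℝ, ℝ) I ∞ γ 0 ∧ γ 0 = x ∧ (∀ᶠ t in 𝓝 (0 : ℝ), γ t ∈ S) ∧
    mfderiv 𝓘(ℝ, ℝ) I γ 0 (1 : ℝ) = X}

/-- The annihilator `(T_x S)⁰ ⊆ T*_x M`. -/
def conormalSpace (I : ModelWithCorners ℝ E H) {M : Type*} [TopologicalSpace M]
    [ChartedSpace H M] (S : Set M) (x : M) : Set (CotangentSpace I x) :=
  {Λ | ∀ X ∈ submanifoldTangent I S x, Λ X = (0 : ℝ)}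

/-- Fields of real functions of two tangent vectors; the two-forms used below are of this type. -/
abbrev TwoForm (I : ModelWithCorners ℝ E H) (M : Type*) [TopologicalSpace M]
    [ChartedSpace H M] : Type _ :=
  (x : M) → TangentSpace I x → TangentSpace I x → ℝ

/-- The pull-back `f^* Ω` of a two-form. -/
noncomputable def TwoForm.pullback {I : ModelWithCorners ℝ E H} {I' : ModelWithCorners ℝ E' H'}
    {M M' : Type*} [TopologicalSpace M] [ChartedSpace H M] [TopologicalSpace M']
    [ChartedSpace H' M'] (f : M → M') (Ω : TwoForm I' M') : TwoForm I M :=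
  fun x X Y => Ω (f x) (mfderiv I I' f x X) (mfderiv I I' f x Y)

/-- `S` is a Lagrangian submanifold of `(M, Ω)`: an embedded submanifold each of whose tangent
spaces is equal to its own `Ω`-orthogonal. -/
def IsLagrangianSubmanifold {I : ModelWithCorners ℝ E H} {M : Type*} [TopologicalSpace M]
    [ChartedSpace H M] (Ω : TwoForm I M) (S : Set M) : Prop :=
  IsEmbeddedSubmanifold I S ∧
  ∀ x ∈ S, submanifoldTangent I S x = {X | ∀ Y ∈ submanifoldTangent I S x, Ω x X Y = 0}

/-! ### The canonical symplectic forms -/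

/-- The canonical symplectic form `ω_M = dp_i ∧ dq^i` of `T*M`. In Mathlib a tangent vector of
`T*M` at `α` is its pair of components `(q̇, ṗ) ∈ E × E*` in the preferred chart at `α`, that is, in
the natural coordinates `(q, p)` induced by the preferred chart of `M` at the base point of `α`. -/
def canonicalForm (I : ModelWithCorners ℝ E H) (M : Type*) [TopologicalSpace M]
    [ChartedSpace H M] [IsManifold I ∞ M] : TwoForm (cotangentModel I) (CotangentBundle I M) :=
  fun _ (X Y : E × (E →L[ℝ] ℝ)) => X.2 Y.1 - Y.2 X.1

/-- The symplectic form `pr₂^* ω_M - pr₁^* ω_M` of `T*M × T*M`. -/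
noncomputable def differenceForm (I : ModelWithCorners ℝ E H) (M : Type*) [TopologicalSpace M]
    [ChartedSpace H M] [IsManifold I ∞ M] :
    TwoForm ((cotangentModel I).prod (cotangentModel I))
      (CotangentBundle I M × CotangentBundle I M) :=
  fun x X Y =>
    TwoForm.pullback (I := (cotangentModel I).prod (cotangentModel I)) Prod.snd (canonicalForm I M)
        x X Y -
      TwoForm.pullback (I := (cotangentModel I).prod (cotangentModel I)) Prod.fst
        (canonicalForm I M) x X Y

/-! ### Cotangent lift of a map `TQ → Q × Q` -/

/-- The cotangent lift `F̂ = (TF⁻¹)^* : T*M → T*M'` of a diffeomorphism `F`, that is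
`F̂ (μ) = μ ∘ (T_x F)⁻¹` over `F x` for `μ ∈ T*_x M`; it is meaningful at the points where `T_x F` is
invertible. -/
noncomputable def cotangentLift (I : ModelWithCorners ℝ E H) (I' : ModelWithCorners ℝ E' H')
    {M M' : Type*} [TopologicalSpace M] [ChartedSpace H M] [TopologicalSpace M']
    [ChartedSpace H' M'] (F : M → M') (μ : CotangentBundle I M) : CotangentBundle I' M' :=
  ⟨F μ.proj, μ.snd ∘L (mfderiv I I' F μ.proj).inverse⟩

theorem coprod_inl_eq (r p : E →L[ℝ] ℝ) :
    (r.coprod p : E × E →L[ℝ] ℝ) ∘L ContinuousLinearMap.inl ℝ E E = r := by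
  ext; simp

theorem coprod_inr_eq (r p : E →L[ℝ] ℝ) :
    (r.coprod p : E × E →L[ℝ] ℝ) ∘L ContinuousLinearMap.inr ℝ E E = p := by
  ext; simp

theorem neg_coprod_inr_eq (p₀ p₁ : E →L[ℝ] ℝ) :
    ((-p₀).coprod p₁ : E × E →L[ℝ] ℝ) ∘L ContinuousLinearMap.inr ℝ E E = p₁ :=
  coprod_inr_eq _ _

theorem coprod_inl_inr_eq (Λ : E × E →L[ℝ] ℝ) :
    (Λ ∘L ContinuousLinearMap.inl ℝ E E).coprod (Λ ∘L ContinuousLinearMap.inr ℝ E E) = Λ := by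
  ext <;> simp

theorem neg_neg_coprod_eq (Λ : E × E →L[ℝ] ℝ) :
    (- -(Λ ∘L ContinuousLinearMap.inl ℝ E E)).coprod (Λ ∘L ContinuousLinearMap.inr ℝ E E) = Λ := by
  ext <;> simp

theorem neg_coprod_inl_eq (p₀ p₁ : E →L[ℝ] ℝ) :
    -(((-p₀).coprod p₁ : E × E →L[ℝ] ℝ) ∘L ContinuousLinearMap.inl ℝ E E) = p₀ := by
  ext; simp

/-- Tulczyjew's canonical map `α_Q : TT*Q → T*TQ`, `(q, p, q̇, ṗ) ↦ (q, q̇, ṗ, p)`: the vector with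
components `(q̇, ṗ)` at `(q, p)` goes to the covector `(δq, δv) ↦ ṗ (δq) + p (δv)` at `(q, q̇)`. All
components refer to the natural coordinates induced by the preferred chart of `Q` at `q`. -/
noncomputable def tulczyjew (I : ModelWithCorners ℝ E H) (Q : Type*) [TopologicalSpace Q]
    [ChartedSpace H Q] [IsManifold I ∞ Q] :
    TangentBundle (cotangentModel I) (CotangentBundle I Q) ≃
      CotangentBundle I.tangent (TangentBundle I Q) where
  toFun X :=
    let p : E →L[ℝ] ℝ := X.proj.snd
    let Z : E × (E →L[ℝ] ℝ) := X.snd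
    let v : TangentBundle I Q := ⟨X.proj.proj, Z.1⟩
    let Λ : E × E →L[ℝ] ℝ := Z.2.coprod p
    ⟨v, Λ⟩
  invFun μ :=
    let Λ : E × E →L[ℝ] ℝ := μ.snd
    let w : E := μ.proj.snd
    let p : E →L[ℝ] ℝ := Λ ∘L ContinuousLinearMap.inr ℝ E E
    let a : CotangentBundle I Q := ⟨μ.proj.proj, p⟩
    let Z : E × (E →L[ℝ] ℝ) := (w, Λ ∘L ContinuousLinearMap.inl ℝ E E)
    ⟨a, Z⟩
  left_inv X := by
    rcases X with ⟨⟨q, p⟩, ⟨w, r⟩⟩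
    exact congrArg₂ (fun p' r' : E →L[ℝ] ℝ =>
      ((⟨(⟨q, p'⟩ : CotangentBundle I Q), ((w, r') : E × (E →L[ℝ] ℝ))⟩ :
        TangentBundle (cotangentModel I) (CotangentBundle I Q))))
      (coprod_inr_eq (E := E) r p) (coprod_inl_eq (E := E) r p)
  right_inv μ := by
    rcases μ with ⟨⟨q, w⟩, Λ⟩
    exact congrArg (fun Λ' : E × E →L[ℝ] ℝ =>
      (⟨⟨q, w⟩, Λ'⟩ : CotangentBundle I.tangent (TangentBundle I Q)))
      (coprod_inl_inr_eq (E := E) Λ)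

/-- The map `Φ : T*Q × T*Q → T*(Q × Q)`, `(q₀, p₀; q₁, p₁) ↦ (q₀, q₁, -p₀, p₁)`. -/
noncomputable def productCovector (I : ModelWithCorners ℝ E H) (Q : Type*) [TopologicalSpace Q]
    [ChartedSpace H Q] :
    CotangentBundle I Q × CotangentBundle I Q ≃ CotangentBundle (I.prod I) (Q × Q) where
  toFun a :=
    let p₀ : E →L[ℝ] ℝ := a.1.snd
    let p₁ : E →L[ℝ] ℝ := a.2.snd
    let Λ : E × E →L[ℝ] ℝ := (-p₀).coprod p₁
    ⟨(a.1.proj, a.2.proj), Λ⟩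
  invFun ν :=
    let Λ : E × E →L[ℝ] ℝ := ν.snd
    let p₀ : E →L[ℝ] ℝ := -(Λ ∘L ContinuousLinearMap.inl ℝ E E)
    let p₁ : E →L[ℝ] ℝ := Λ ∘L ContinuousLinearMap.inr ℝ E E
    (⟨ν.proj.1, p₀⟩, ⟨ν.proj.2, p₁⟩)
  left_inv a := by
    rcases a with ⟨⟨q₀, p₀⟩, ⟨q₁, p₁⟩⟩
    exact congrArg₂ (fun p₀' p₁' : E →L[ℝ] ℝ =>
      (((⟨q₀, p₀'⟩, ⟨q₁, p₁'⟩) : CotangentBundle I Q × CotangentBundle I Q)))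
      (neg_coprod_inl_eq (E := E) p₀ p₁)
      (neg_coprod_inr_eq (E := E) p₀ p₁)
  right_inv ν := by
    rcases ν with ⟨⟨q₀, q₁⟩, Λ⟩
    exact congrArg (fun Λ' : E × E →L[ℝ] ℝ =>
      (⟨(q₀, q₁), Λ'⟩ : CotangentBundle (I.prod I) (Q × Q)))
      (neg_neg_coprod_eq (E := E) Λ)

/-- The cotangent lift `R^{T*} = Φ⁻¹ ∘ R̂ ∘ α_Q : TT*Q → T*Q × T*Q` of a map `R : TQ → Q × Q`. -/
noncomputable def discretizationLift (I : ModelWithCorners ℝ E H) {Q : Type*} [TopologicalSpace Q]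
    [ChartedSpace H Q] [IsManifold I ∞ Q] (R : TangentBundle I Q → Q × Q)
    (X : TangentBundle (cotangentModel I) (CotangentBundle I Q)) :
    CotangentBundle I Q × CotangentBundle I Q :=
  (productCovector I Q).symm (cotangentLift I.tangent (I.prod I) R (tulczyjew I Q X))

/-! ### Discretization maps and the modified constrained problem -/

/-- `R` is a discretization map of `Q` on the open neighbourhood `U` of the zero section of `TQ`. -/
structure IsDiscretizationMap (I : ModelWithCorners ℝ E H) {Q : Type*} [TopologicalSpace Q]
    [ChartedSpace H Q] [IsManifold I ∞ Q] (U : Set (TangentBundle I Q)) (R : TangentBundle I Q → Q × Q) : Prop where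
  isOpen : IsOpen U
  zero_mem : ∀ x : Q, (⟨x, 0⟩ : TangentBundle I Q) ∈ U
  smooth : ContMDiffOn I.tangent (I.prod I) ∞ R U
  map_zero : ∀ x : Q, R ⟨x, 0⟩ = (x, x)
  deriv_zero : ∀ x : Q,
    let T₁ : E →L[ℝ] E := mfderiv 𝓘(ℝ, E) I (fun v : E => (R ⟨x, v⟩).1) 0
    let T₂ : E →L[ℝ] E := mfderiv 𝓘(ℝ, E) I (fun v : E => (R ⟨x, v⟩).2) 0
    T₂ - T₁ = ContinuousLinearMap.id ℝ E

/-- Fibrewise multiplication by `h` on `TQ`. -/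
noncomputable def fiberScale (I : ModelWithCorners ℝ E H) {Q : Type*} [TopologicalSpace Q] [ChartedSpace H Q]
    (h : ℝ) (v : TangentBundle I Q) : TangentBundle I Q :=
  ⟨v.proj, h • v.snd⟩

/-- `R^h (v) = R (h v)`. -/
noncomputable def scaledMap (I : ModelWithCorners ℝ E H) {Q : Type*} [TopologicalSpace Q] [ChartedSpace H Q]
    (R : TangentBundle I Q → Q × Q) (h : ℝ) (v : TangentBundle I Q) : Q × Q :=
  R (fiberScale I h v)

/-- The constraint set `(R^h)⁻¹ (i N × i N)` in `TQ`, for the map `Rh = R^h` with domain `D`. -/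
def modifiedConstraint (I : ModelWithCorners ℝ E H) {Q N : Type*} [TopologicalSpace Q]
    [ChartedSpace H Q] (i : N → Q) (D : Set (TangentBundle I Q)) (Rh : TangentBundle I Q → Q × Q) :
    Set (TangentBundle I Q) :=
  {v | v ∈ D ∧ Rh v ∈ range i ×ˢ range i}

/-- `Σ = {μ ∈ T*M | π μ ∈ C, μ - dL ∈ (T C)⁰}` for a submanifold `C` of `M` and `L : M → ℝ`. -/
def constrainedDifferential (I : ModelWithCorners ℝ E H) {M : Type*} [TopologicalSpace M]
    [ChartedSpace H M] (C : Set M) (L : M → ℝ) : Set (CotangentBundle I M) :=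
  {μ | μ.proj ∈ C ∧ μ.snd - differential I L μ.proj ∈ conormalSpace I C μ.proj}

/-- `S̃_d = α_Q⁻¹ (Σ)`, where `Σ` is given by the function `L` on `TQ` and the constraint set
`(R^h)⁻¹ (i N × i N)`. -/
def modifiedDynamics (I : ModelWithCorners ℝ E H) {Q N : Type*} [TopologicalSpace Q]
    [ChartedSpace H Q] [IsManifold I ∞ Q] (i : N → Q) (D : Set (TangentBundle I Q))
    (Rh : TangentBundle I Q → Q × Q) (L : TangentBundle I Q → ℝ) :
    Set (TangentBundle (cotangentModel I) (CotangentBundle I Q)) :=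
  tulczyjew I Q ⁻¹' constrainedDifferential I.tangent (modifiedConstraint I i D Rh) L

/-- `i^* p ∈ T*_x N` for `p ∈ T*_{i x} Q`, given by `⟨i^* p, w⟩ = ⟨p, T_x i (w)⟩`. -/
noncomputable def covectorPullback (I : ModelWithCorners ℝ E H) (I' : ModelWithCorners ℝ E' H')
    {N Q : Type*} [TopologicalSpace N] [ChartedSpace H N] [TopologicalSpace Q] [ChartedSpace H' Q]
    (i : N → Q) (x : N) (p : CotangentSpace I' (i x)) : CotangentBundle I N :=
  ⟨x, p ∘L mfderiv I I' i x⟩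

/-- The image `(i^* × i^*) (A)` in `T*N × T*N` of a set `A` of pairs of covectors of `Q` over points
of `i N`. -/
def pullbackPairs (I : ModelWithCorners ℝ E H) (I' : ModelWithCorners ℝ E' H')
    {N Q : Type*} [TopologicalSpace N] [ChartedSpace H N] [TopologicalSpace Q] [ChartedSpace H' Q]
    (i : N → Q) (A : Set (CotangentBundle I' Q × CotangentBundle I' Q)) :
    Set (CotangentBundle I N × CotangentBundle I N) :=
  {b | ∃ (x₀ x₁ : N) (p₀ : CotangentSpace I' (i x₀)) (p₁ : CotangentSpace I' (i x₁)),
    ((⟨i x₀, p₀⟩, ⟨i x₁, p₁⟩) : CotangentBundle I' Q × CotangentBundle I' Q) ∈ A ∧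
    b = (covectorPullback I I' i x₀ p₀, covectorPullback I I' i x₁ p₁)}

end Geometry

/-! ### Fibre translations by exact one-forms followed by cotangent lifts, in a vector space. -/

section ShiftedLift

variable {B : Type*} [NormedAddCommGroup B] [NormedSpace ℝ B]

/-! Let `f` be the scaled discretization map on `D`, `g` its inverse on the open set `f '' D`, and
`ℓ = L̃ ∘ g`. Tulczyjew's map is a bijection, so it cancels against the preimage defining the
dynamics, and the cotangent lift of `f` only transports the data
(`cotangentLift_image_constrainedDifferential`). The set in question is therefore `Φ⁻¹` of the
affine conormal set of covectors `Λ` over `C = (i N × i N) ∩ f(D)` such that `Λ - dℓ` annihilates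
`TC`.

Such a set is Lagrangian for every embedded submanifold `C` and every function `ℓ` smooth on an open
set containing `C` (`isLagrangianSubmanifold_generated`). Translation by `-dℓ` followed by the
cotangent lift of a slice chart of `C` is symplectic and straightens the set to `V × V⁰`, a
Lagrangian linear subspace. The sign in `Φ` turns the canonical form of the product into the
difference form. Over each point of `C` the fibre contains `dℓ`, which gives the projection
statement.

Pulling back by `i × i` yields the same kind of set on `N × N` (`pullbackPairs_generated`), with
function `ℓ ∘ (i × i)` and with an open set as constraint: the graph of a differential, up to the
sign in `Φ`. The same Lagrangian lemma applies to it. -/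

theorem fderiv_symm_comp_fderiv {φ : OpenPartialHomeomorph B B}
    (hφ : ContDiffOn ℝ ∞ φ φ.source) (hφ' : ContDiffOn ℝ ∞ φ.symm φ.target) {y : B}
    (hy : y ∈ φ.source) :
    fderiv ℝ φ.symm (φ y) ∘L fderiv ℝ φ y = ContinuousLinearMap.id ℝ B := by
  have h1 : HasFDerivAt φ (fderiv ℝ φ y) y :=
    ((hφ.contDiffAt (φ.open_source.mem_nhds hy)).differentiableAt (by simp)).hasFDerivAt
  have h2 : HasFDerivAt φ.symm (fderiv ℝ φ.symm (φ y)) (φ y) :=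
    ((hφ'.contDiffAt (φ.open_target.mem_nhds (φ.map_source hy))).differentiableAt
      (by simp)).hasFDerivAt
  exact (h2.comp y h1).unique
    ((hasFDerivAt_id y).congr_of_eventuallyEq (φ.eventually_left_inverse hy))

/-- The map `(y, P) ↦ (φ y, (P - dℓ) ∘ (Dφ)⁻¹)`, the composition of the fibrewise translation by
`-dℓ` and the cotangent lift of `φ`. -/
noncomputable def shiftedLift (φ : OpenPartialHomeomorph B B) (ℓ : B → ℝ)
    (hφ : ContDiffOn ℝ ∞ φ φ.source) (hφ' : ContDiffOn ℝ ∞ φ.symm φ.target)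
    (hℓ : ContDiffOn ℝ ∞ ℓ φ.source) :
    OpenPartialHomeomorph (B × (B →L[ℝ] ℝ)) (B × (B →L[ℝ] ℝ)) where
  toFun a := (φ a.1, (a.2 - fderiv ℝ ℓ a.1) ∘L fderiv ℝ φ.symm (φ a.1))
  invFun b := (φ.symm b.1, b.2 ∘L fderiv ℝ φ (φ.symm b.1) + fderiv ℝ ℓ (φ.symm b.1))
  source := φ.source ×ˢ univ
  target := φ.target ×ˢ univ
  map_source' a ha := ⟨φ.map_source ha.1, mem_univ _⟩
  map_target' b hb := ⟨φ.map_target hb.1, mem_univ _⟩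
  left_inv' a ha := by
    have h := fderiv_symm_comp_fderiv hφ hφ' ha.1
    refine Prod.ext (φ.left_inv ha.1) ?_
    simp only [φ.left_inv ha.1, ContinuousLinearMap.comp_assoc, h]
    simp
  right_inv' b hb := by
    have h := fderiv_symm_comp_fderiv (φ := φ.symm) hφ' hφ hb.1
    rw [φ.symm_symm] at h
    refine Prod.ext (φ.right_inv hb.1) ?_
    simp only [φ.right_inv hb.1, add_sub_cancel_right, ContinuousLinearMap.comp_assoc, h]
    simp
  open_source := φ.open_source.prod isOpen_univ
  open_target := φ.open_target.prod isOpen_univ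
  continuousOn_toFun := by
    have h1 : ContinuousOn (fun a : B × (B →L[ℝ] ℝ) => φ a.1) (φ.source ×ˢ univ) :=
      φ.continuousOn.comp continuousOn_fst fun a ha => ha.1
    have h2 : ContinuousOn (fun a : B × (B →L[ℝ] ℝ) => fderiv ℝ ℓ a.1) (φ.source ×ˢ univ) :=
      (hℓ.continuousOn_fderiv_of_isOpen φ.open_source (by simp)).comp continuousOn_fst
        fun a ha => ha.1
    have h3 : ContinuousOn (fun a : B × (B →L[ℝ] ℝ) => fderiv ℝ φ.symm (φ a.1))
        (φ.source ×ˢ univ) :=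
      (hφ'.continuousOn_fderiv_of_isOpen φ.open_target (by simp)).comp h1
        fun a ha => φ.map_source ha.1
    exact h1.prodMk ((continuousOn_snd.sub h2).clm_comp h3)
  continuousOn_invFun := by
    have h1 : ContinuousOn (fun a : B × (B →L[ℝ] ℝ) => φ.symm a.1) (φ.target ×ˢ univ) :=
      φ.symm.continuousOn.comp continuousOn_fst fun a ha => ha.1
    have h2 : ContinuousOn (fun a : B × (B →L[ℝ] ℝ) => fderiv ℝ ℓ (φ.symm a.1))
        (φ.target ×ˢ univ) :=
      (hℓ.continuousOn_fderiv_of_isOpen φ.open_source (by simp)).comp h1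
        fun a ha => φ.map_target ha.1
    have h3 : ContinuousOn (fun a : B × (B →L[ℝ] ℝ) => fderiv ℝ φ (φ.symm a.1))
        (φ.target ×ˢ univ) :=
      (hφ.continuousOn_fderiv_of_isOpen φ.open_source (by simp)).comp h1
        fun a ha => φ.map_target ha.1
    exact h1.prodMk ((continuousOn_snd.clm_comp h3).add h2)

variable {φ : OpenPartialHomeomorph B B} {ℓ : B → ℝ}
    (hφ : ContDiffOn ℝ ∞ φ φ.source) (hφ' : ContDiffOn ℝ ∞ φ.symm φ.target)
    (hℓ : ContDiffOn ℝ ∞ ℓ φ.source)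

theorem shiftedLift_apply (a : B × (B →L[ℝ] ℝ)) :
    shiftedLift φ ℓ hφ hφ' hℓ a =
      (φ a.1, (a.2 - fderiv ℝ ℓ a.1) ∘L fderiv ℝ φ.symm (φ a.1)) :=
  rfl

theorem contDiffOn_shiftedLift :
    ContDiffOn ℝ ∞ (shiftedLift φ ℓ hφ hφ' hℓ) (shiftedLift φ ℓ hφ hφ' hℓ).source := by
  have h1 : ContDiffOn ℝ ∞ (fun a : B × (B →L[ℝ] ℝ) => φ a.1) (φ.source ×ˢ univ) :=
    hφ.comp contDiffOn_fst fun a ha => ha.1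
  have h2 : ContDiffOn ℝ ∞ (fun a : B × (B →L[ℝ] ℝ) => fderiv ℝ ℓ a.1) (φ.source ×ˢ univ) :=
    (hℓ.fderiv_of_isOpen φ.open_source (by simp)).comp contDiffOn_fst fun a ha => ha.1
  have h3 : ContDiffOn ℝ ∞ (fun a : B × (B →L[ℝ] ℝ) => fderiv ℝ φ.symm (φ a.1))
      (φ.source ×ˢ univ) :=
    (hφ'.fderiv_of_isOpen φ.open_target (by simp)).comp h1 fun a ha => φ.map_source ha.1
  exact h1.prodMk ((contDiffOn_snd.sub h2).clm_comp h3)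

theorem contDiffOn_shiftedLift_symm :
    ContDiffOn ℝ ∞ (shiftedLift φ ℓ hφ hφ' hℓ).symm (shiftedLift φ ℓ hφ hφ' hℓ).target := by
  have h1 : ContDiffOn ℝ ∞ (fun a : B × (B →L[ℝ] ℝ) => φ.symm a.1) (φ.target ×ˢ univ) :=
    hφ'.comp contDiffOn_fst fun a ha => ha.1
  have h2 : ContDiffOn ℝ ∞ (fun a : B × (B →L[ℝ] ℝ) => fderiv ℝ ℓ (φ.symm a.1))
      (φ.target ×ˢ univ) :=
    (hℓ.fderiv_of_isOpen φ.open_source (by simp)).comp h1 fun a ha => φ.map_target ha.1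
  have h3 : ContDiffOn ℝ ∞ (fun a : B × (B →L[ℝ] ℝ) => fderiv ℝ φ (φ.symm a.1))
      (φ.target ×ˢ univ) :=
    (hφ.fderiv_of_isOpen φ.open_source (by simp)).comp h1 fun a ha => φ.map_target ha.1
  exact h1.prodMk ((contDiffOn_snd.clm_comp h3).add h2)

/-- The standard symplectic form `dP ∧ dy` of `B × B*`. -/
def standardForm (X Y : B × (B →L[ℝ] ℝ)) : ℝ :=
  X.2 Y.1 - Y.2 X.1

/-- Differentiating the fibre component produces second derivatives of `ℓ` and of `φ⁻¹`. Both are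
symmetric, so they cancel in the antisymmetric form; in the remaining terms `D(φ⁻¹)` cancels `Dφ`.
-/
theorem standardForm_fderiv_shiftedLift {a : B × (B →L[ℝ] ℝ)} (ha : a.1 ∈ φ.source)
    (X Y : B × (B →L[ℝ] ℝ)) :
    standardForm (fderiv ℝ (shiftedLift φ ℓ hφ hφ' hℓ) a X)
      (fderiv ℝ (shiftedLift φ ℓ hφ hφ' hℓ) a Y) = standardForm X Y := by
  have hy' := φ.map_source ha
  have hφa := hφ.contDiffAt (φ.open_source.mem_nhds ha)
  have hφ'a := hφ'.contDiffAt (φ.open_target.mem_nhds hy')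
  have hℓa := hℓ.contDiffAt (φ.open_source.mem_nhds ha)
  have h1 : HasFDerivAt (fun a : B × (B →L[ℝ] ℝ) => φ a.1)
      (fderiv ℝ φ a.1 ∘L ContinuousLinearMap.fst ℝ B (B →L[ℝ] ℝ)) a :=
    (hφa.differentiableAt (by simp)).hasFDerivAt.comp a hasFDerivAt_fst
  have h2 : HasFDerivAt (fun a : B × (B →L[ℝ] ℝ) => fderiv ℝ ℓ a.1)
      (fderiv ℝ (fderiv ℝ ℓ) a.1 ∘L ContinuousLinearMap.fst ℝ B (B →L[ℝ] ℝ)) a :=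
    ((hℓa.fderiv_right (m := ∞) (by simp)).differentiableAt
      (by simp)).hasFDerivAt.comp a hasFDerivAt_fst
  have h3 : HasFDerivAt (fun a : B × (B →L[ℝ] ℝ) => fderiv ℝ φ.symm (φ a.1))
      (fderiv ℝ (fderiv ℝ φ.symm) (φ a.1) ∘L
        (fderiv ℝ φ a.1 ∘L ContinuousLinearMap.fst ℝ B (B →L[ℝ] ℝ))) a :=
    HasFDerivAt.comp a ((hφ'a.fderiv_right (m := ∞) (by simp)).differentiableAt
      (by simp)).hasFDerivAt h1
  have h4 := h1.prodMk ((hasFDerivAt_snd.sub h2).clm_comp h3)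
  have h5 : fderiv ℝ (shiftedLift φ ℓ hφ hφ' hℓ) a = _ := h4.fderiv
  have h6 : ∀ X : B × (B →L[ℝ] ℝ), fderiv ℝ (shiftedLift φ ℓ hφ hφ' hℓ) a X =
      (fderiv ℝ φ a.1 X.1,
        (a.2 - fderiv ℝ ℓ a.1) ∘L (fderiv ℝ (fderiv ℝ φ.symm) (φ a.1) (fderiv ℝ φ a.1 X.1)) +
          (X.2 - fderiv ℝ (fderiv ℝ ℓ) a.1 X.1) ∘L fderiv ℝ φ.symm (φ a.1)) := fun X => by
    rw [h5]; rfl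
  have hm : minSmoothness ℝ 2 ≤ ∞ := by
    rw [minSmoothness_of_isRCLikeNormedField]; exact WithTop.coe_le_coe.2 (le_top : (2 : ℕ∞) ≤ ⊤)
  have s1 := (hℓa.isSymmSndFDerivAt hm) X.1 Y.1
  have s2 := (hφ'a.isSymmSndFDerivAt hm) (fderiv ℝ φ a.1 X.1) (fderiv ℝ φ a.1 Y.1)
  have e : ∀ v, fderiv ℝ φ.symm (φ a.1) (fderiv ℝ φ a.1 v) = v := fun v =>
    congrArg (fun T : B →L[ℝ] B => T v) (fderiv_symm_comp_fderiv hφ hφ' ha)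
  simp only [h6, standardForm, add_apply, ContinuousLinearMap.comp_apply,
    sub_apply, e, s1, s2]
  ring

end ShiftedLift

/-! ### Tangent spaces of submanifolds, slice charts, and images of embeddings. -/

section Submanifold

theorem Submodule.mem_of_forall_annihilator {E : Type*} [NormedAddCommGroup E] [NormedSpace ℝ E]
    [FiniteDimensional ℝ E] (V : Submodule ℝ E) {x : E}
    (h : ∀ ψ : E →L[ℝ] ℝ, (∀ v ∈ V, ψ v = 0) → ψ x = 0) : x ∈ V := by
  by_contra hx
  obtain ⟨ψ, hψ, hV⟩ := V.exists_dual_map_eq_bot_of_notMem hx inferInstance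
  refine hψ (h (LinearMap.toContinuousLinearMap ψ) fun v hv => ?_)
  have : ψ v ∈ V.map ψ := Submodule.mem_map_of_mem hv
  simpa [hV] using this

variable {E : Type*} [NormedAddCommGroup E] [NormedSpace ℝ E]
  {H : Type*} [TopologicalSpace H] {I : ModelWithCorners ℝ E H}
  {M : Type*} [TopologicalSpace M] [ChartedSpace H M]
  {E' : Type*} [NormedAddCommGroup E'] [NormedSpace ℝ E']
  {H' : Type*} [TopologicalSpace H'] {I' : ModelWithCorners ℝ E' H'}
  {M' : Type*} [TopologicalSpace M'] [ChartedSpace H' M']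

theorem mfderiv_leftInverse_apply {f : M → M'} {g : M' → M} {x : M}
    (hf : MDifferentiableAt I I' f x) (hg : MDifferentiableAt I' I g (f x))
    (h : ∀ᶠ y in 𝓝 x, g (f y) = y) (X : TangentSpace I x) :
    mfderiv I' I g (f x) (mfderiv I I' f x X) = X := by
  have h1 := (hg.hasMFDerivAt.comp x hf.hasMFDerivAt)
  have h2 : HasMFDerivAt I I (g ∘ f) x (ContinuousLinearMap.id ℝ (TangentSpace I x)) :=
    (hasMFDerivAt_id x).congr_of_eventuallyEq h
  exact congrArg (fun T : E →L[ℝ] E => T X) (hasMFDerivAt_unique h1 h2)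

/-- Allows the base point `y` to equal `f x` only propositionally, as when `f` is a chart inverse;
the values are compared in the model spaces to avoid transport between tangent spaces. -/
theorem mfderiv_comp_apply_of_eq' {E'' : Type*} [NormedAddCommGroup E''] [NormedSpace ℝ E'']
    {H'' : Type*} [TopologicalSpace H''] {I'' : ModelWithCorners ℝ E'' H''}
    {M'' : Type*} [TopologicalSpace M''] [ChartedSpace H'' M'']
    {f : M → M'} {g : M' → M''} {x : M} {y : M'} (hg : MDifferentiableAt I' I'' g y)
    (hf : MDifferentiableAt I I' f x) (hy : f x = y) (X : TangentSpace I x) :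
    (mfderiv I I'' (g ∘ f) x X : E'') = mfderiv I' I'' g y (mfderiv I I' f x X : E') := by
  subst hy
  rw [mfderiv_comp x hg hf]
  rfl

theorem mfderiv_apply_mfderiv_symm {e : OpenPartialHomeomorph M E} {x : M} (hx : x ∈ e.source)
    (he : ContMDiffOn I 𝓘(ℝ, E) ∞ e e.source) (he' : ContMDiffOn 𝓘(ℝ, E) I ∞ e.symm e.target)
    (Z : E) : (mfderiv I 𝓘(ℝ, E) e x (mfderiv 𝓘(ℝ, E) I e.symm (e x) Z) : E) = Z := by
  have h1 := (he.contMDiffAt (e.open_source.mem_nhds hx)).mdifferentiableAt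
    (by simp : (∞ : ℕ∞ω) ≠ 0)
  have h2 := (he'.contMDiffAt (e.open_target.mem_nhds (e.map_source hx))).mdifferentiableAt
    (by simp : (∞ : ℕ∞ω) ≠ 0)
  have h3 := mfderiv_leftInverse_apply (x := e x) h2 (by rw [e.left_inv hx]; exact h1)
    (e.eventually_right_inverse (e.map_source hx)) Z
  rwa [e.left_inv hx] at h3

theorem mfderiv_symm_apply_mfderiv {e : OpenPartialHomeomorph M E} {x : M} (hx : x ∈ e.source)
    (he : ContMDiffOn I 𝓘(ℝ, E) ∞ e e.source) (he' : ContMDiffOn 𝓘(ℝ, E) I ∞ e.symm e.target)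
    (X : TangentSpace I x) : mfderiv 𝓘(ℝ, E) I e.symm (e x) (mfderiv I 𝓘(ℝ, E) e x X) = X :=
  mfderiv_leftInverse_apply
    ((he.contMDiffAt (e.open_source.mem_nhds hx)).mdifferentiableAt (by simp))
    ((he'.contMDiffAt (e.open_target.mem_nhds (e.map_source hx))).mdifferentiableAt (by simp))
    (e.eventually_left_inverse hx) X

/-- Tangent vectors are velocities, so the curve is composed with `f`. Only its germ matters, hence
the local hypothesis on `S`. -/
theorem mfderiv_mem_submanifoldTangent {f : M → M'} {x : M} {S : Set M} {S' : Set M'}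
    (hf : ContMDiffAt I I' ∞ f x) (hS : ∀ᶠ y in 𝓝 x, y ∈ S → f y ∈ S') {X : TangentSpace I x}
    (hX : X ∈ submanifoldTangent I S x) :
    mfderiv I I' f x X ∈ submanifoldTangent I' S' (f x) := by
  obtain ⟨γ, hγ, rfl, hγS, rfl⟩ := hX
  refine ⟨f ∘ γ, hf.comp 0 hγ, rfl, ?_, ?_⟩
  · filter_upwards [hγS, hγ.continuousAt.eventually hS] with t h1 h2 using h2 h1
  · rw [mfderiv_comp (I' := I) 0 (hf.mdifferentiableAt (by simp)) (hγ.mdifferentiableAt (by simp))]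
    rfl

theorem mfderiv_mem_submanifoldTangent_iff {f : M → M'} {g : M' → M} {x : M} {S : Set M}
    {S' : Set M'} (hf : ContMDiffAt I I' ∞ f x) (hg : ContMDiffAt I' I ∞ g (f x))
    (hgf : ∀ᶠ y in 𝓝 x, g (f y) = y)
    (hS : ∀ᶠ y in 𝓝 x, y ∈ S → f y ∈ S') (hS' : ∀ᶠ z in 𝓝 (f x), z ∈ S' → g z ∈ S)
    {X : TangentSpace I x} :
    mfderiv I I' f x X ∈ submanifoldTangent I' S' (f x) ↔ X ∈ submanifoldTangent I S x := by
  refine ⟨fun h => ?_, mfderiv_mem_submanifoldTangent hf hS⟩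
  have h1 := mfderiv_mem_submanifoldTangent hg hS' h
  rw [mfderiv_leftInverse_apply (hf.mdifferentiableAt (by simp)) (hg.mdifferentiableAt (by simp))
    hgf] at h1
  rw [← hgf.self_of_nhds]
  exact h1

/-- A functional vanishing on `V` vanishes along the curve, hence on its velocity, and such
functionals cut out `V`. Conversely, straight lines realize all vectors of `V`. -/
theorem submodule_tangent [FiniteDimensional ℝ E] (V : Submodule ℝ E) {x : E} (hx : x ∈ V) :
    submanifoldTangent 𝓘(ℝ, E) (V : Set E) x = (V : Set E) := by
  ext X
  constructor
  · rintro ⟨γ, hγ, rfl, hγV, rfl⟩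
    have h1 : HasFDerivAt γ (fderiv ℝ γ 0) 0 :=
      (hγ.mdifferentiableAt (by simp)).differentiableAt.hasFDerivAt
    rw [mfderiv_eq_fderiv]
    refine V.mem_of_forall_annihilator fun ψ hψ => ?_
    have h2 : HasFDerivAt (ψ ∘ γ) (ψ ∘L fderiv ℝ γ 0) 0 := ψ.hasFDerivAt.comp 0 h1
    have h3 : HasFDerivAt (ψ ∘ γ) (0 : ℝ →L[ℝ] ℝ) 0 :=
      (hasFDerivAt_const (0 : ℝ) (0 : ℝ)).congr_of_eventuallyEq
        (hγV.mono fun t ht => hψ _ ht)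
    exact congrArg (fun T : ℝ →L[ℝ] ℝ => T 1) (h2.unique h3)
  · intro hX
    obtain ⟨Y, rfl⟩ : ∃ Y : E, Y = X := ⟨X, rfl⟩
    have h1 : HasDerivAt (fun t : ℝ => x + t • Y) ((1 : ℝ) • Y) 0 :=
      ((hasDerivAt_id (0 : ℝ)).smul_const Y).const_add x
    refine ⟨fun t => x + t • Y, ?_, by simp, ?_, ?_⟩
    · exact ContDiffAt.contMDiffAt
        (contDiffAt_const.add (contDiffAt_id.smul contDiffAt_const))
    · exact Filter.Eventually.of_forall fun t => V.add_mem hx (V.smul_mem t hX)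
    · rw [mfderiv_eq_fderiv, h1.hasFDerivAt.fderiv]
      change (1 : ℝ) • ((1 : ℝ) • Y) = Y
      simp

/-- In a slice chart, the tangent space of a submanifold is the slice. -/
theorem mem_submanifoldTangent_iff_of_slice [FiniteDimensional ℝ E] {S : Set M} {x : M}
    {e : OpenPartialHomeomorph M E} {V : Submodule ℝ E} (hx : x ∈ e.source) (hxS : x ∈ S)
    (he : ContMDiffOn I 𝓘(ℝ, E) ∞ e e.source) (he' : ContMDiffOn 𝓘(ℝ, E) I ∞ e.symm e.target)
    (hS : ∀ y ∈ e.source, y ∈ S ↔ e y ∈ V) {X : TangentSpace I x} :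
    X ∈ submanifoldTangent I S x ↔ (mfderiv I 𝓘(ℝ, E) e x X : E) ∈ V := by
  have h := mfderiv_mem_submanifoldTangent_iff (S := S) (S' := (V : Set E)) (X := X)
    (he.contMDiffAt (e.open_source.mem_nhds hx))
    (he'.contMDiffAt (e.open_target.mem_nhds (e.map_source hx)))
    (e.eventually_left_inverse hx)
    (Filter.mem_of_superset (e.open_source.mem_nhds hx) fun y hy h => (hS y hy).1 h)
    (Filter.mem_of_superset (e.open_target.mem_nhds (e.map_source hx)) fun z hz h =>
      (hS _ (e.map_target hz)).2 (by rw [e.right_inv hz]; exact h))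
  rw [← h, submodule_tangent V ((hS x hx).1 hxS)]
  rfl

theorem IsEmbeddedSubmanifold.inter_isOpen {S W : Set M} (hS : IsEmbeddedSubmanifold I S)
    (hW : IsOpen W) : IsEmbeddedSubmanifold I (S ∩ W) := by
  rintro x ⟨hx, hxW⟩
  obtain ⟨e, V, hxe, he, he', hV⟩ := hS x hx
  have hsub : (e.restrOpen W hW).target ⊆ e.target := fun z hz => hz.1
  refine ⟨e.restrOpen W hW, V, ⟨hxe, hxW⟩, he.mono inter_subset_left, he'.mono hsub, ?_⟩
  rintro y ⟨hye, hyW⟩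
  exact (and_iff_left hyW).trans (hV y hye)

/-- The extended chart of a boundaryless manifold, as an open partial homeomorphism. -/
noncomputable def openExtChartAt (I : ModelWithCorners ℝ E H) [I.Boundaryless] (x : M) :
    OpenPartialHomeomorph M E where
  toPartialEquiv := extChartAt I x
  open_source := isOpen_extChartAt_source x
  open_target := isOpen_extChartAt_target x
  continuousOn_toFun := continuousOn_extChartAt x
  continuousOn_invFun := continuousOn_extChartAt_symm x

theorem contMDiffOn_openExtChartAt [I.Boundaryless] [IsManifold I ∞ M] (x : M) :
    ContMDiffOn I 𝓘(ℝ, E) ∞ (openExtChartAt I x) (openExtChartAt I x).source := by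
  have h := contMDiffOn_extChartAt (I := I) (n := ∞) (x := x)
  rwa [← extChartAt_source I x] at h

theorem contMDiffOn_openExtChartAt_symm [I.Boundaryless] [IsManifold I ∞ M] (x : M) :
    ContMDiffOn 𝓘(ℝ, E) I ∞ (openExtChartAt I x).symm (openExtChartAt I x).target :=
  contMDiffOn_extChartAt_symm x

theorem IsOpen.isEmbeddedSubmanifold [I.Boundaryless] [IsManifold I ∞ M] {W : Set M}
    (hW : IsOpen W) : IsEmbeddedSubmanifold I W := by
  rw [← univ_inter W]
  refine IsEmbeddedSubmanifold.inter_isOpen (fun x _ => ?_) hW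
  exact ⟨openExtChartAt I x, ⊤, mem_extChartAt_source x, contMDiffOn_openExtChartAt x,
    contMDiffOn_openExtChartAt_symm x, by simp⟩

open Manifold in
theorem Manifold.IsImmersionAt.extend_codChart_apply {n : ℕ∞ω} {f : M → M'} {x : M}
    (h : IsImmersionAt I I' n f x) {y : M} (hy : y ∈ h.domChart.source) :
    h.codChart.extend I' (f y) = h.equiv (h.domChart.extend I y, 0) := by
  have hy' : y ∈ (h.domChart.extend I).source := by
    rwa [OpenPartialHomeomorph.extend_source]
  have h1 : h.codChart.extend I' (f ((h.domChart.extend I).symm (h.domChart.extend I y))) =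
    h.equiv (h.domChart.extend I y, 0) := h.writtenInCharts ((h.domChart.extend I).map_source hy')
  rwa [(h.domChart.extend I).left_inv hy'] at h1

open Manifold in
/-- An immersion has local smooth left inverses. -/
theorem Manifold.IsImmersionAt.exists_leftInverse [I.Boundaryless] {n : ℕ∞ω}
    [IsManifold I n M] [IsManifold I' n M'] {f : M → M'} {x : M} (h : IsImmersionAt I I' n f x) :
    ∃ ρ : M' → M, ContMDiffAt I' I n ρ (f x) ∧ ∀ᶠ y in 𝓝 x, ρ (f y) = y := by
  have hx : x ∈ (h.domChart.extend I).source := by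
    rw [OpenPartialHomeomorph.extend_source]
    exact h.mem_domChart_source
  have hfx := h.mem_codChart_source
  -- In immersion charts `f` is `u ↦ (u, 0)`; the left inverse is the projection to the first
  -- factor.
  refine ⟨fun z => (h.domChart.extend I).symm (h.equiv.symm (h.codChart.extend I' z)).1, ?_, ?_⟩
  · have h1 : ContMDiffAt I' 𝓘(ℝ, E') n (h.codChart.extend I') (f x) :=
      h.codChart.contMDiffAt_extend h.codChart_mem_maximalAtlas hfx
    have h2 : ContMDiffAt 𝓘(ℝ, E') 𝓘(ℝ, E) n (fun z => (h.equiv.symm z).1)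
        (h.codChart.extend I' (f x)) :=
      (contDiff_fst.comp h.equiv.symm.contDiff).contMDiff.contMDiffAt
    have h3 := contMDiffOn_extend_symm h.domChart_mem_maximalAtlas
    rw [← h.domChart.extend_target'] at h3
    refine ContMDiffAt.comp (f x) (h3.contMDiffAt ?_) (h2.comp (f x) h1)
    refine h.domChart.isOpen_extend_target.mem_nhds ?_
    rw [h.extend_codChart_apply h.mem_domChart_source, ContinuousLinearEquiv.symm_apply_apply]
    exact (h.domChart.extend I).map_source hx
  · filter_upwards [h.domChart.open_source.mem_nhds h.mem_domChart_source] with y hy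
    rw [h.extend_codChart_apply hy, ContinuousLinearEquiv.symm_apply_apply]
    exact (h.domChart.extend I).left_inv (by rwa [OpenPartialHomeomorph.extend_source])

open Manifold in
/-- The vectors tangent to a subset of the image of an embedding come from vectors tangent to its
preimage. -/
theorem Manifold.IsSmoothEmbedding.exists_mfderiv_eq {f : M → M'} [IsManifold I ∞ M]
    [IsManifold I' ∞ M'] (hf : IsSmoothEmbedding I I' ∞ f) {x : M} {S : Set M'}
    (hS : S ⊆ range f) {Y : TangentSpace I' (f x)} (hY : Y ∈ submanifoldTangent I' S (f x)) :
    ∃ X ∈ submanifoldTangent I (f ⁻¹' S) x, mfderiv I I' f x X = Y := by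
  obtain ⟨γ, hγ, hγ0, hγS, rfl⟩ := hY
  -- The curve is lifted pointwise, with `x` as a dummy value at the times when it is outside `S`.
  have h1 : ∀ t, ∃ m, γ t ∈ S → f m = γ t := fun t => by
    by_cases ht : γ t ∈ S
    · obtain ⟨m, hm⟩ := hS ht
      exact ⟨m, fun _ => hm⟩
    · exact ⟨x, fun h => absurd h ht⟩
  choose c hc using h1
  have h2 : f ∘ c =ᶠ[𝓝 0] γ := hγS.mono fun t ht => hc t ht
  have hc0 : c 0 = x := hf.isEmbedding.injective ((hc 0 hγS.self_of_nhds).trans hγ0)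
  -- The lift is continuous at `0` because `f` is inducing; for a continuous lift, smoothness can be
  -- tested after composing with an immersion.
  have h3 : ContMDiffAt 𝓘(ℝ, ℝ) I ∞ c 0 := by
    rw [ContMDiffAt.iff_comp_isImmersionAt (hf.isImmersion.isImmersionAt (c 0))]
    exact ⟨hf.isEmbedding.isInducing.continuousAt_iff.2 (hγ.continuousAt.congr h2.symm),
      hγ.congr_of_eventuallyEq h2⟩
  refine ⟨(mfderiv 𝓘(ℝ, ℝ) I c 0 (1 : ℝ) : E), ⟨c, h3, hc0, ?_, rfl⟩, ?_⟩
  · filter_upwards [hγS] with t ht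
    change f (c t) ∈ S
    rwa [hc t ht]
  · have h4 := mfderiv_comp_apply_of_eq' (hf.contMDiff.mdifferentiableAt (by simp))
      (h3.mdifferentiableAt (by simp)) hc0 (1 : ℝ)
    refine h4.symm.trans ?_
    rw [h2.mfderiv_eq]
    rfl

open Manifold in
theorem Manifold.IsSmoothEmbedding.isEmbeddedSubmanifold_range [I.Boundaryless] [I'.Boundaryless]
    [IsManifold I ∞ M] [IsManifold I' ∞ M'] {f : M → M'} (hf : IsSmoothEmbedding I I' ∞ f) :
    IsEmbeddedSubmanifold I' (range f) := by
  rintro _ ⟨x, rfl⟩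
  have h := hf.isImmersion.isImmersionAt x
  -- This is where embedding, and not just immersion, is used: inside `O` the image of `f` has no
  -- sheets coming from outside the domain chart.
  obtain ⟨O, hO, hOf⟩ := hf.isEmbedding.isOpen_iff.1 h.domChart.open_source
  set ψ := h.codChart.extend I' with hψ
  set χ := h.domChart.extend I with hχ
  let c : OpenPartialHomeomorph M' E' :=
    { toPartialEquiv := ψ
      open_source := h.codChart.isOpen_extend_source
      open_target := h.codChart.isOpen_extend_target
      continuousOn_toFun := h.codChart.continuousOn_extend
      continuousOn_invFun := h.codChart.continuousOn_extend_symm }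
  -- Points whose first component lies in the chart's target; without this a point of the slice need
  -- not be of the form `(χ u, 0)`.
  let T : Set E' := (fun z => (h.equiv.symm z).1) ⁻¹' χ.target
  have hT : IsOpen T :=
    h.domChart.isOpen_extend_target.preimage (continuous_fst.comp h.equiv.symm.continuous)
  have hcT : IsOpen (c.source ∩ c ⁻¹' T ∩ O) := (c.isOpen_inter_preimage hT).inter hO
  have key : ∀ y ∈ h.domChart.source, ψ (f y) = h.equiv (χ y, 0) := fun y hy =>
    h.extend_codChart_apply hy
  let V : Submodule ℝ E' :=
    (LinearMap.range (LinearMap.inl ℝ E h.complement)).map h.equiv.toLinearMap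
  have hV : ∀ z : E', z ∈ V ↔ (h.equiv.symm z).2 = 0 := by
    intro z
    constructor
    · rintro ⟨_, ⟨u, rfl⟩, rfl⟩
      simp
    · intro hz
      exact ⟨(h.equiv.symm z), ⟨(h.equiv.symm z).1, Prod.ext rfl hz.symm⟩,
        h.equiv.apply_symm_apply z⟩
  have hsource : ∀ y ∈ h.domChart.source, y ∈ χ.source := fun y hy => by
    rwa [hχ, OpenPartialHomeomorph.extend_source]
  refine ⟨c.restrOpen _ hcT, V, ?_, ?_, ?_, ?_⟩
  · have hx := h.mem_domChart_source
    have hxc : f x ∈ c.source := by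
      change f x ∈ (h.codChart.extend I').source
      rw [OpenPartialHomeomorph.extend_source]
      exact h.mem_codChart_source
    refine ⟨hxc, ⟨hxc, ?_⟩, ?_⟩
    · change (h.equiv.symm (ψ (f x))).1 ∈ χ.target
      rw [key x hx, ContinuousLinearEquiv.symm_apply_apply]
      exact χ.map_source (hsource x hx)
    · exact hOf.superset hx
  · have h1 := h.codChart.contMDiffOn_extend h.codChart_mem_maximalAtlas
    rw [← h.codChart.extend_source (I := I')] at h1
    exact h1.mono inter_subset_left
  · have h1 := contMDiffOn_extend_symm h.codChart_mem_maximalAtlas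
    rw [← h.codChart.extend_target'] at h1
    exact h1.mono inter_subset_left
  · rintro y ⟨-, ⟨hyc, hyT⟩, hyO⟩
    change _ ↔ ψ y ∈ V
    rw [hV]
    constructor
    · rintro ⟨u, rfl⟩
      have hu : u ∈ h.domChart.source := hOf.subset hyO
      rw [key u hu]
      simp
    · intro hy
      have hyT' : (h.equiv.symm (ψ y)).1 ∈ χ.target := hyT
      have hu := χ.map_target hyT'
      have hu' : χ.symm (h.equiv.symm (ψ y)).1 ∈ h.domChart.source := by
        rwa [hχ, OpenPartialHomeomorph.extend_source] at hu
      refine ⟨χ.symm (h.equiv.symm (ψ y)).1, ?_⟩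
      have hfu := h.source_subset_preimage_source hu'
      have h1 := key _ hu'
      rw [χ.right_inv hyT', ← hy, Prod.mk.eta, ContinuousLinearEquiv.apply_symm_apply] at h1
      refine ψ.injOn ?_ hyc h1
      rw [hψ, OpenPartialHomeomorph.extend_source]
      exact hfu

end Submanifold

/-! ### Lagrangian slices and the linear model `V × V⁰`. -/

section LagrangianChart

variable {E : Type*} [NormedAddCommGroup E] [NormedSpace ℝ E]
  {H : Type*} [TopologicalSpace H] {I : ModelWithCorners ℝ E H}
  {M : Type*} [TopologicalSpace M] [ChartedSpace H M]

/-- A set that is, around each of its points, a Lagrangian linear slice in a chart whose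
differential at the point is symplectic, is a Lagrangian submanifold. -/
theorem isLagrangianSubmanifold_of_slices [FiniteDimensional ℝ E] {Ω : TwoForm I M} {S : Set M}
    (h : ∀ x ∈ S, ∃ (e : OpenPartialHomeomorph M E) (V : Submodule ℝ E) (Ω₀ : E → E → ℝ),
      x ∈ e.source ∧ ContMDiffOn I 𝓘(ℝ, E) ∞ e e.source ∧
      ContMDiffOn 𝓘(ℝ, E) I ∞ e.symm e.target ∧ (∀ y ∈ e.source, y ∈ S ↔ e y ∈ V) ∧
      (∀ X Y : TangentSpace I x,
        Ω x X Y = Ω₀ (mfderiv I 𝓘(ℝ, E) e x X) (mfderiv I 𝓘(ℝ, E) e x Y)) ∧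
      ∀ Z, Z ∈ V ↔ ∀ Z' ∈ V, Ω₀ Z Z' = 0) :
    IsLagrangianSubmanifold Ω S := by
  constructor
  · intro x hx
    obtain ⟨e, V, -, h1, h2, h3, h4, -⟩ := h x hx
    exact ⟨e, V, h1, h2, h3, h4⟩
  · intro x hx
    obtain ⟨e, V, Ω₀, h1, h2, h3, h4, h5, h6⟩ := h x hx
    have hT : ∀ X : TangentSpace I x,
        X ∈ submanifoldTangent I S x ↔ (mfderiv I 𝓘(ℝ, E) e x X : E) ∈ V := fun X =>
      mem_submanifoldTangent_iff_of_slice h1 hx h2 h3 h4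
    ext X
    refine (hT X).trans ((h6 _).trans ?_)
    constructor
    · intro hX Y hY
      rw [h5]
      exact hX _ ((hT Y).1 hY)
    · intro hX Z hZ
      -- Every `Z ∈ V` is the image under `De` of a tangent vector of `S`, namely `D(e⁻¹) Z`.
      have hr := mfderiv_apply_mfderiv_symm h1 h2 h3 Z
      have h8 := hX (mfderiv 𝓘(ℝ, E) I e.symm (e x) Z : E) ((hT _).2 (by rw [hr]; exact hZ))
      have h9 := h5 X (mfderiv 𝓘(ℝ, E) I e.symm (e x) Z)
      rw [hr] at h9
      exact h9.symm.trans h8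

/-- The annihilator of a subspace in the topological dual. -/
def Submodule.topDualAnnihilator (V : Submodule ℝ E) : Submodule ℝ (E →L[ℝ] ℝ) where
  carrier := {r | ∀ v ∈ V, r v = 0}
  add_mem' ha hb v hv := by simp [ha v hv, hb v hv]
  zero_mem' v _ := rfl
  smul_mem' c r hr v hv := by simp [hr v hv]

/-- Pairing with `(0, ψ)`, `ψ ∈ V⁰`, forces the first component into `V` by double annihilation;
pairing with `(v, 0)` forces the second into `V⁰`. -/
theorem mem_prod_topDualAnnihilator_iff [FiniteDimensional ℝ E] (V : Submodule ℝ E)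
    (Z : E × (E →L[ℝ] ℝ)) :
    Z ∈ V.prod V.topDualAnnihilator ↔
      ∀ Z' ∈ V.prod V.topDualAnnihilator, standardForm Z Z' = 0 := by
  constructor
  · rintro ⟨h1, h2⟩ Z' ⟨h3, h4⟩
    simp [standardForm, h2 _ h3, h4 _ h1]
  · intro h
    refine ⟨V.mem_of_forall_annihilator fun ψ hψ => ?_, fun v hv => ?_⟩
    · simpa [standardForm] using h (0, ψ) ⟨V.zero_mem, hψ⟩
    · simpa [standardForm] using h (v, 0) ⟨hv, Submodule.zero_mem _⟩

/-- The linear isomorphism `(y₀, p₀; y₁, p₁) ↦ (y₀, y₁; -p₀, p₁)`. -/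
noncomputable def phaseEquiv (E : Type*) [NormedAddCommGroup E] [NormedSpace ℝ E] :
    ((E × (E →L[ℝ] ℝ)) × (E × (E →L[ℝ] ℝ))) ≃L[ℝ] (E × E) × ((E × E) →L[ℝ] ℝ) :=
  (ContinuousLinearEquiv.prodProdProdComm ℝ E (E →L[ℝ] ℝ) E (E →L[ℝ] ℝ)).trans
    ((ContinuousLinearEquiv.refl ℝ (E × E)).prodCongr
      (((ContinuousLinearEquiv.neg ℝ).prodCongr (ContinuousLinearEquiv.refl ℝ (E →L[ℝ] ℝ))).trans
        (ContinuousLinearMap.coprodEquivL ℝ)))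

theorem phaseEquiv_apply (X : (E × (E →L[ℝ] ℝ)) × (E × (E →L[ℝ] ℝ))) :
    phaseEquiv E X = ((X.1.1, X.2.1), (-X.1.2).coprod X.2.2) :=
  rfl

/-- The minus sign on `p₀` is exactly what converts the sum of the two canonical forms into their
difference. -/
theorem standardForm_phaseEquiv (X Y : (E × (E →L[ℝ] ℝ)) × (E × (E →L[ℝ] ℝ))) :
    standardForm (phaseEquiv E X) (phaseEquiv E Y) =
      (X.2.2 Y.2.1 - Y.2.2 X.2.1) - (X.1.2 Y.1.1 - Y.1.2 X.1.1) := by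
  simp only [standardForm, phaseEquiv_apply, ContinuousLinearMap.coprod_apply, neg_apply]
  ring

/-- The coordinate expression of the covector `Λ - dℓ` at `p`, evaluated on a vector given by its
components in a second chart. -/
theorem covector_sub_fderiv_eq {χ c : OpenPartialHomeomorph M E}
    (hχ : ContMDiffOn I 𝓘(ℝ, E) ∞ χ χ.source) (hχ' : ContMDiffOn 𝓘(ℝ, E) I ∞ χ.symm χ.target)
    (hc' : ContMDiffOn 𝓘(ℝ, E) I ∞ c.symm c.target) {p : M} (hp : p ∈ χ.source)
    (hpc : p ∈ c.source) {ℓ : M → ℝ} (hℓ : ContMDiffAt I 𝓘(ℝ, ℝ) ∞ ℓ p) (Λ : E →L[ℝ] ℝ) (Z : E) :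
    Λ (mfderiv 𝓘(ℝ, E) I χ.symm (χ p) (fderiv ℝ (χ ∘ c.symm) (c p) Z)) -
      fderiv ℝ (ℓ ∘ χ.symm) (χ p) (fderiv ℝ (χ ∘ c.symm) (c p) Z) =
    Λ (mfderiv 𝓘(ℝ, E) I c.symm (c p) Z) -
      differential I ℓ p (mfderiv 𝓘(ℝ, E) I c.symm (c p) Z) := by
  have n0 : (∞ : ℕ∞ω) ≠ 0 := by simp
  have dχ : MDifferentiableAt I 𝓘(ℝ, E) χ p :=
    (hχ.contMDiffAt (χ.open_source.mem_nhds hp)).mdifferentiableAt n0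
  have dχ' : MDifferentiableAt 𝓘(ℝ, E) I χ.symm (χ p) :=
    (hχ'.contMDiffAt (χ.open_target.mem_nhds (χ.map_source hp))).mdifferentiableAt n0
  have dc' : MDifferentiableAt 𝓘(ℝ, E) I c.symm (c p) :=
    (hc'.contMDiffAt (c.open_target.mem_nhds (c.map_source hpc))).mdifferentiableAt n0
  have dℓ : MDifferentiableAt I 𝓘(ℝ, ℝ) ℓ p := hℓ.mdifferentiableAt n0
  have h1 : fderiv ℝ (χ ∘ c.symm) (c p) Z =
      mfderiv I 𝓘(ℝ, E) χ p (mfderiv 𝓘(ℝ, E) I c.symm (c p) Z : E) := by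
    rw [← mfderiv_eq_fderiv]
    exact mfderiv_comp_apply_of_eq' dχ dc' (c.left_inv hpc) Z
  have h2 : ∀ Y : E, fderiv ℝ (ℓ ∘ χ.symm) (χ p) Y =
      differential I ℓ p (mfderiv 𝓘(ℝ, E) I χ.symm (χ p) Y : E) := fun Y => by
    rw [← mfderiv_eq_fderiv]
    exact mfderiv_comp_apply_of_eq' dℓ dχ' (χ.left_inv hp) Y
  have h3 := mfderiv_symm_apply_mfderiv hp hχ hχ'
  rw [h2, h1]
  have h4 := h3 (mfderiv 𝓘(ℝ, E) I c.symm (c p) Z)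
  exact congrArg (fun W : E => Λ W - differential I ℓ p W) h4

end LagrangianChart

/-! ### Affine conormal sets in `T*M × T*M` are Lagrangian. -/

section GeneratedRelation

variable {E : Type*} [NormedAddCommGroup E] [NormedSpace ℝ E]
  {M : Type*} [TopologicalSpace M] [ChartedSpace E M] [IsManifold 𝓘(ℝ, E) ∞ M]

theorem differenceForm_eq (a : CotangentBundle 𝓘(ℝ, E) M × CotangentBundle 𝓘(ℝ, E) M)
    (X Y : (E × (E →L[ℝ] ℝ)) × (E × (E →L[ℝ] ℝ))) :
    differenceForm 𝓘(ℝ, E) M a X Y = standardForm (phaseEquiv E X) (phaseEquiv E Y) := by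
  rw [standardForm_phaseEquiv]
  unfold differenceForm TwoForm.pullback
  rw [mfderiv_fst, mfderiv_snd]
  rfl

/-- The trivialization of the bundle of homomorphisms is conjugation by those of its two factors:
the trivial line contributes the identity, the tangent bundle the derivative of the inverse chart.
-/
theorem cotangent_extChartAt_apply (a b : CotangentBundle 𝓘(ℝ, E) M)
    (hb : b.proj ∈ (chartAt E a.proj).source) :
    extChartAt (cotangentModel 𝓘(ℝ, E)) a b =
      (extChartAt 𝓘(ℝ, E) a.proj b.proj,
        (b.snd : E →L[ℝ] ℝ) ∘L (mfderiv 𝓘(ℝ, E) 𝓘(ℝ, E) (extChartAt 𝓘(ℝ, E) a.proj).symm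
          (extChartAt 𝓘(ℝ, E) a.proj b.proj) : E →L[ℝ] E)) := by
  have h1 : IsManifold 𝓘(ℝ, E) 1 M := IsManifold.of_le (n := ∞) (by simp)
  have h2 := TangentBundle.symmL_trivializationAt (I := 𝓘(ℝ, E)) hb
  rw [modelWithCornersSelf_coe, range_id, mfderivWithin_univ] at h2
  refine Prod.ext rfl ?_
  rw [← h2]
  have h3 : (extChartAt (cotangentModel 𝓘(ℝ, E)) a b).2 =
      ((trivializationAt ℝ (Bundle.Trivial M ℝ) a.proj).continuousLinearMapAt ℝ b.proj ∘L
        (b.snd ∘L (trivializationAt E (TangentSpace 𝓘(ℝ, E)) a.proj).symmL ℝ b.proj)) := rfl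
  have h4 : (trivializationAt ℝ (Bundle.Trivial M ℝ) a.proj).continuousLinearMapAt ℝ b.proj =
      ContinuousLinearMap.id ℝ ℝ := Bundle.Trivial.continuousLinearMapAt_trivialization ..
  exact h3.trans (ContinuousLinearMap.ext fun v => congrArg (fun T : ℝ →L[ℝ] ℝ =>
    T (b.snd ((trivializationAt E (TangentSpace 𝓘(ℝ, E)) a.proj).symmL ℝ b.proj v))) h4)

theorem mfderiv_prod_extChartAt_symm (c : M × M) {y : E × E}
    (hy : y ∈ (openExtChartAt (𝓘(ℝ, E).prod 𝓘(ℝ, E)) c).target) :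
    mfderiv 𝓘(ℝ, E × E) (𝓘(ℝ, E).prod 𝓘(ℝ, E)) (openExtChartAt (𝓘(ℝ, E).prod 𝓘(ℝ, E)) c).symm y =
      (mfderiv 𝓘(ℝ, E) 𝓘(ℝ, E) (extChartAt 𝓘(ℝ, E) c.1).symm y.1 : E →L[ℝ] E).prodMap
        (mfderiv 𝓘(ℝ, E) 𝓘(ℝ, E) (extChartAt 𝓘(ℝ, E) c.2).symm y.2 : E →L[ℝ] E) := by
  have hy' : y ∈ (extChartAt (𝓘(ℝ, E).prod 𝓘(ℝ, E)) c).target := hy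
  rw [extChartAt_prod] at hy'
  have hd : ∀ (q : M) (z : E), z ∈ (extChartAt 𝓘(ℝ, E) q).target →
      MDifferentiableAt 𝓘(ℝ, E) 𝓘(ℝ, E) (extChartAt 𝓘(ℝ, E) q).symm z := fun q z hz =>
    ((contMDiffOn_extChartAt_symm (n := ∞) q).contMDiffAt
      ((isOpen_extChartAt_target q).mem_nhds hz)).mdifferentiableAt (by simp)
  have h1 : HasMFDerivAt 𝓘(ℝ, E × E) 𝓘(ℝ, E) Prod.fst y (ContinuousLinearMap.fst ℝ E E) :=
    hasFDerivAt_fst.hasMFDerivAt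
  have h2 : HasMFDerivAt 𝓘(ℝ, E × E) 𝓘(ℝ, E) Prod.snd y (ContinuousLinearMap.snd ℝ E E) :=
    hasFDerivAt_snd.hasMFDerivAt
  have h3 := ((hd c.1 y.1 hy'.1).hasMFDerivAt.comp y h1).prodMk
    ((hd c.2 y.2 hy'.2).hasMFDerivAt.comp y h2)
  exact h3.mfderiv

/-- In natural coordinates, the identification of `T*M × T*M` with `T*(M × M)` is the linear
isomorphism `phaseEquiv`. -/
theorem phaseEquiv_extChartAt (a b : CotangentBundle 𝓘(ℝ, E) M × CotangentBundle 𝓘(ℝ, E) M)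
    (hb : (b.1.proj, b.2.proj) ∈
      (openExtChartAt (𝓘(ℝ, E).prod 𝓘(ℝ, E)) (a.1.proj, a.2.proj)).source) :
    phaseEquiv E (extChartAt ((cotangentModel 𝓘(ℝ, E)).prod (cotangentModel 𝓘(ℝ, E))) a b) =
      (openExtChartAt (𝓘(ℝ, E).prod 𝓘(ℝ, E)) (a.1.proj, a.2.proj) (b.1.proj, b.2.proj),
        ((productCovector 𝓘(ℝ, E) M b).snd : E × E →L[ℝ] ℝ) ∘L
        (mfderiv 𝓘(ℝ, E × E) (𝓘(ℝ, E).prod 𝓘(ℝ, E))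
          (openExtChartAt (𝓘(ℝ, E).prod 𝓘(ℝ, E)) (a.1.proj, a.2.proj)).symm
          (openExtChartAt (𝓘(ℝ, E).prod 𝓘(ℝ, E)) (a.1.proj, a.2.proj)
            (b.1.proj, b.2.proj)) : E × E →L[ℝ] E × E)) := by
  rw [mfderiv_prod_extChartAt_symm _ (OpenPartialHomeomorph.map_source _ hb)]
  have hb' : (b.1.proj, b.2.proj) ∈
      (extChartAt (𝓘(ℝ, E).prod 𝓘(ℝ, E)) (a.1.proj, a.2.proj)).source := hb
  rw [extChartAt_prod] at hb'
  have h1 := cotangent_extChartAt_apply a.1 b.1 (by rw [← extChartAt_source 𝓘(ℝ, E)]; exact hb'.1)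
  have h2 := cotangent_extChartAt_apply a.2 b.2 (by rw [← extChartAt_source 𝓘(ℝ, E)]; exact hb'.2)
  rw [extChartAt_prod]
  change phaseEquiv E (extChartAt _ a.1 b.1, extChartAt _ a.2 b.2) = _
  rw [h1, h2, phaseEquiv_apply]
  refine Prod.ext rfl ?_
  refine ContinuousLinearMap.ext fun v => ?_
  change (-_ : E →L[ℝ] ℝ) _ + _ = (-_ : E →L[ℝ] ℝ) _ + _
  rfl

/-- Composing natural coordinates with the shifted lift of the transition to a slice chart of `C`
gives a chart, symplectic at the given point, that flattens the set to `V × V⁰`. -/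
theorem isLagrangianSubmanifold_generated [FiniteDimensional ℝ E] {C W : Set (M × M)}
    {ℓ : M × M → ℝ} (hC : IsEmbeddedSubmanifold (𝓘(ℝ, E).prod 𝓘(ℝ, E)) C) (hW : IsOpen W)
    (hCW : C ⊆ W) (hℓ : ContMDiffOn (𝓘(ℝ, E).prod 𝓘(ℝ, E)) 𝓘(ℝ, ℝ) ∞ ℓ W) :
    IsLagrangianSubmanifold (differenceForm 𝓘(ℝ, E) M)
      (productCovector 𝓘(ℝ, E) M ⁻¹' constrainedDifferential (𝓘(ℝ, E).prod 𝓘(ℝ, E)) C ℓ) := by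
  refine isLagrangianSubmanifold_of_slices fun a ha => ?_
  obtain ⟨c₀, V, hc₀, hc, hc', hV⟩ := hC _ ha.1
  have ha₀ : (a.1.proj, a.2.proj) ∈ C := ha.1
  set χ := openExtChartAt (𝓘(ℝ, E).prod 𝓘(ℝ, E)) (a.1.proj, a.2.proj)
  have hχ : ContMDiffOn (𝓘(ℝ, E).prod 𝓘(ℝ, E)) 𝓘(ℝ, E × E) ∞ χ χ.source :=
    contMDiffOn_openExtChartAt _
  have hχ' : ContMDiffOn 𝓘(ℝ, E × E) (𝓘(ℝ, E).prod 𝓘(ℝ, E)) ∞ χ.symm χ.target :=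
    contMDiffOn_openExtChartAt_symm _
  -- Restricting the slice chart to `W` makes `ℓ ∘ χ.symm` smooth on the whole source of `φ`, the
  -- transition from natural coordinates to slice coordinates.
  let c := c₀.restrOpen W hW
  let φ := χ.symm.trans c
  have hφ : ContDiffOn ℝ ∞ φ φ.source :=
    (hc.comp (hχ'.mono inter_subset_left) fun y hy => hy.2.1).contDiffOn
  have hφ' : ContDiffOn ℝ ∞ φ.symm φ.target :=
    (hχ.comp (hc'.mono fun z hz => hz.1.1) fun z hz => hz.2).contDiffOn
  have hℓ' : ContDiffOn ℝ ∞ (ℓ ∘ χ.symm) φ.source :=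
    (hℓ.comp (hχ'.mono inter_subset_left) fun y hy => hy.2.2).contDiffOn
  let P := (phaseEquiv E).toHomeomorph.toOpenPartialHomeomorph
  let Ψ := shiftedLift φ (ℓ ∘ χ.symm) hφ hφ' hℓ'
  let Ξ := (P.trans Ψ).trans P.symm
  let κ := openExtChartAt ((cotangentModel 𝓘(ℝ, E)).prod (cotangentModel 𝓘(ℝ, E))) a
  have hκ : ContMDiffOn _ 𝓘(ℝ, _) ∞ κ κ.source := contMDiffOn_openExtChartAt a
  have hκ' : ContMDiffOn 𝓘(ℝ, _) _ ∞ κ.symm κ.target := contMDiffOn_openExtChartAt_symm a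
  have hΞ : ContDiffOn ℝ ∞ Ξ Ξ.source :=
    (phaseEquiv E).symm.contDiff.comp_contDiffOn
      ((contDiffOn_shiftedLift hφ hφ' hℓ').comp (phaseEquiv E).contDiff.contDiffOn
        fun X hX => hX.1.2)
  have hΞ' : ContDiffOn ℝ ∞ Ξ.symm Ξ.target :=
    (phaseEquiv E).symm.contDiff.comp_contDiffOn
      ((contDiffOn_shiftedLift_symm hφ hφ' hℓ').comp (phaseEquiv E).contDiff.contDiffOn
        fun X hX => hX.2.1)
  have hκsource : ∀ b ∈ κ.source, (b.1.proj, b.2.proj) ∈ χ.source := by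
    intro b hb
    have hb' : b ∈ (extChartAt ((cotangentModel 𝓘(ℝ, E)).prod (cotangentModel 𝓘(ℝ, E))) a).source :=
      hb
    change _ ∈ (extChartAt (𝓘(ℝ, E).prod 𝓘(ℝ, E)) (a.1.proj, a.2.proj)).source
    rw [extChartAt_prod] at hb' ⊢
    have h1 := hb'.1
    have h2 := hb'.2
    rw [FiberBundle.extChartAt] at h1 h2
    exact ⟨h1.2.1, h2.2.1⟩
  have hκφ : ∀ b ∈ κ.source, (b.1.proj, b.2.proj) ∈ c.source →
      (phaseEquiv E (κ b)).1 ∈ φ.source := by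
    intro b hb hbc
    have h1 := congrArg Prod.fst (phaseEquiv_extChartAt a b (hκsource b hb))
    change (phaseEquiv E (κ b)).1 = χ (b.1.proj, b.2.proj) at h1
    rw [h1]
    refine ⟨χ.map_source (hκsource b hb), ?_⟩
    change χ.symm _ ∈ c.source
    rwa [χ.left_inv (hκsource b hb)]
  have haκ : a ∈ κ.source := mem_extChartAt_source a
  have haΞ : κ a ∈ Ξ.source :=
    ⟨⟨mem_univ _, hκφ a haκ ⟨hc₀, hCW ha₀⟩, mem_univ _⟩, mem_univ _⟩
  refine ⟨κ.trans Ξ, (V.prod V.topDualAnnihilator).comap (phaseEquiv E).toLinearMap,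
    fun X Y => standardForm (phaseEquiv E X) (phaseEquiv E Y), ?_, ?_, ?_, ?_, ?_, ?_⟩
  · exact ⟨haκ, haΞ⟩
  · exact hΞ.contMDiffOn.comp (hκ.mono inter_subset_left) fun b hb => hb.2
  · exact hκ'.comp (hΞ'.contMDiffOn.mono inter_subset_left) fun b hb => hb.2
  · rintro b ⟨hb, hbΞ⟩
    have hpχ := hκsource b hb
    have hy : (phaseEquiv E (κ b)).1 ∈ φ.source := hbΞ.1.2.1
    have hk := phaseEquiv_extChartAt a b hpχ
    set p : M × M := (b.1.proj, b.2.proj)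
    set Λ : E × E →L[ℝ] ℝ := (productCovector 𝓘(ℝ, E) M b).snd
    change phaseEquiv E (κ b) = (χ p, Λ ∘L _) at hk
    rw [hk] at hy
    have hp : p ∈ c.source := by
      have h1 : χ.symm (χ p) ∈ c.source := hy.2
      rwa [χ.left_inv hpχ] at h1
    -- Identifies the fibre component of `Ψ` with `Λ - dℓ` read in the slice chart, so that
    -- annihilating `V` means annihilating `T_p C`.
    have hcov := covector_sub_fderiv_eq hχ hχ' hc' hpχ hp.1
      (hℓ.contMDiffAt (hW.mem_nhds hp.2)) Λ
    have hΞb : phaseEquiv E (Ξ (κ b)) = Ψ (phaseEquiv E (κ b)) :=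
      ContinuousLinearEquiv.apply_symm_apply _ _
    have hφp : φ (χ p) = c₀ p := congrArg c₀ (χ.left_inv hpχ)
    change _ ↔ phaseEquiv E (Ξ (κ b)) ∈ V.prod V.topDualAnnihilator
    rw [hΞb, hk, shiftedLift_apply]
    change (p ∈ C ∧ ∀ X ∈ submanifoldTangent (𝓘(ℝ, E).prod 𝓘(ℝ, E)) C p, _) ↔
      φ (χ p) ∈ V ∧ ∀ Z ∈ V, _
    rw [hφp, ← hV p hp.1]
    refine and_congr_right fun hpC => ?_
    have hT : ∀ X : E × E, X ∈ submanifoldTangent (𝓘(ℝ, E).prod 𝓘(ℝ, E)) C p ↔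
        (mfderiv (𝓘(ℝ, E).prod 𝓘(ℝ, E)) 𝓘(ℝ, E × E) c₀ p X : E × E) ∈ V := fun X =>
      mem_submanifoldTangent_iff_of_slice hp.1 hpC hc hc' hV (X := X)
    constructor
    · intro h Z hZ
      have h1 := h (mfderiv 𝓘(ℝ, E × E) (𝓘(ℝ, E).prod 𝓘(ℝ, E)) c₀.symm (c₀ p) Z : E × E)
        ((hT _).2 (by rw [mfderiv_apply_mfderiv_symm hp.1 hc hc']; exact hZ))
      exact (hcov Z).trans h1
    · intro h X hX
      have h1 := h _ ((hT X).1 hX)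
      have h2 := (hcov _).symm.trans h1
      have h3 := mfderiv_symm_apply_mfderiv hp.1 hc hc' X
      have h4 : Λ (_ : E × E) - differential (𝓘(ℝ, E).prod 𝓘(ℝ, E)) ℓ p (_ : E × E) = 0 := h2
      rw [h3] at h4
      exact h4
  · intro X Y
    have h1 : HasFDerivAt Ξ (((phaseEquiv E).symm.toContinuousLinearMap ∘L
        fderiv ℝ Ψ (phaseEquiv E (κ a))) ∘L (phaseEquiv E).toContinuousLinearMap) (κ a) := by
      have h2 : HasFDerivAt Ψ (fderiv ℝ Ψ (phaseEquiv E (κ a))) (phaseEquiv E (κ a)) :=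
        (((contDiffOn_shiftedLift hφ hφ' hℓ').contDiffAt (Ψ.open_source.mem_nhds
          ⟨hκφ a haκ ⟨hc₀, hCW ha₀⟩, mem_univ _⟩)).differentiableAt (by simp)).hasFDerivAt
      exact ((phaseEquiv E).symm.hasFDerivAt.comp _ h2).comp _ (phaseEquiv E).hasFDerivAt
    have h3 := h1.hasMFDerivAt.comp a
      ((hκ.contMDiffAt (κ.open_source.mem_nhds haκ)).mdifferentiableAt
        (by simp : (∞ : ℕ∞ω) ≠ 0)).hasMFDerivAt
    have h4 : IsManifold ((cotangentModel 𝓘(ℝ, E)).prod (cotangentModel 𝓘(ℝ, E))) 1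
        (CotangentBundle 𝓘(ℝ, E) M × CotangentBundle 𝓘(ℝ, E) M) :=
      IsManifold.of_le (n := ∞) (by simp)
    -- The preferred chart at `a` has identity derivative at `a`, which is also the chart in whose
    -- components the form is written; only the symplecticity of `Ψ` remains.
    have h5 : mfderiv ((cotangentModel 𝓘(ℝ, E)).prod (cotangentModel 𝓘(ℝ, E))) 𝓘(ℝ, _) κ a =
      ContinuousLinearMap.id ℝ _ := mfderiv_extChartAt_self
    rw [h5] at h3
    have h6 : ∀ X : (E × (E →L[ℝ] ℝ)) × (E × (E →L[ℝ] ℝ)),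
        mfderiv ((cotangentModel 𝓘(ℝ, E)).prod (cotangentModel 𝓘(ℝ, E))) 𝓘(ℝ, _) (κ.trans Ξ) a X =
          (phaseEquiv E).symm (fderiv ℝ Ψ (phaseEquiv E (κ a)) (phaseEquiv E X)) := fun X => by
      have := h3.mfderiv
      exact congrArg (fun T : ((E × (E →L[ℝ] ℝ)) × (E × (E →L[ℝ] ℝ))) →L[ℝ]
        ((E × (E →L[ℝ] ℝ)) × (E × (E →L[ℝ] ℝ))) => T X) this
    have h7 : ∀ X : (E × (E →L[ℝ] ℝ)) × (E × (E →L[ℝ] ℝ)),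
        phaseEquiv E (mfderiv ((cotangentModel 𝓘(ℝ, E)).prod (cotangentModel 𝓘(ℝ, E))) 𝓘(ℝ, _)
          (κ.trans Ξ) a X) = fderiv ℝ Ψ (phaseEquiv E (κ a)) (phaseEquiv E X) := fun X =>
      (congrArg (phaseEquiv E) (h6 X)).trans (ContinuousLinearEquiv.apply_symm_apply _ _)
    exact (differenceForm_eq a X Y).trans ((congrArg₂ standardForm (h7 X) (h7 Y)).trans
      (standardForm_fderiv_shiftedLift hφ hφ' hℓ' (hκφ a haκ ⟨hc₀, hCW ha₀⟩) _ _)).symm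
  · intro Z
    refine (mem_prod_topDualAnnihilator_iff V (phaseEquiv E Z)).trans ?_
    exact ⟨fun h Z' hZ' => h _ hZ', fun h Z' hZ' => by
      simpa using h ((phaseEquiv E).symm Z') (by simpa using hZ')⟩

end GeneratedRelation

/-! ### Inverting the map on its domain and transporting generated sets. -/

section Transport

variable {E : Type*} [NormedAddCommGroup E] [NormedSpace ℝ E]
  {H : Type*} [TopologicalSpace H] {I : ModelWithCorners ℝ E H}
  {M : Type*} [TopologicalSpace M] [ChartedSpace H M]
  {E' : Type*} [NormedAddCommGroup E'] [NormedSpace ℝ E']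
  {H' : Type*} [TopologicalSpace H'] {I' : ModelWithCorners ℝ E' H'}
  {M' : Type*} [TopologicalSpace M'] [ChartedSpace H' M']

/-- An injective local diffeomorphism on an open set has an open image and a smooth inverse. -/
theorem IsLocalDiffeomorphOn.exists_inverse {f : M → M'} {D : Set M} (g₀ : M' → M)
    (hf : IsLocalDiffeomorphOn I I' ∞ f D) (hD : IsOpen D) (hinj : InjOn f D) :
    IsOpen (f '' D) ∧ ∃ g : M' → M, LeftInvOn g f D ∧ ContMDiffOn I' I ∞ g (f '' D) := by
  have hex : ∀ w, ∃ v, w ∈ f '' D → v ∈ D ∧ f v = w := fun w => by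
    by_cases hw : w ∈ f '' D
    · obtain ⟨v, hv, hvw⟩ := hw
      exact ⟨v, fun _ => ⟨hv, hvw⟩⟩
    · exact ⟨g₀ w, fun h => absurd h hw⟩
  choose g hg using hex
  have hloc : ∀ v ∈ D, ∃ k : M' → M, ContMDiffAt I' I ∞ k (f v) ∧
      ∀ᶠ w in 𝓝 (f v), w ∈ f '' D ∧ k w = g w := by
    intro v hv
    have h := hf ⟨v, hv⟩
    refine ⟨h.localInverse, h.localInverse_contMDiffAt, ?_⟩
    have hk : h.localInverse (f v) = v := h.localInverse_left_inv h.localInverse_mem_target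
    have hkD : ∀ᶠ w in 𝓝 (f v), h.localInverse w ∈ D :=
      h.localInverse_contMDiffAt.continuousAt (by rw [hk]; exact hD.mem_nhds hv)
    filter_upwards [hkD, h.localInverse_eventuallyEq_right] with w h1 h2
    have h2' : f (h.localInverse w) = w := h2
    have h3 : w ∈ f '' D := ⟨_, h1, h2'⟩
    -- Injectivity on `D` makes the chosen inverse agree near `f v` with the smooth local inverse,
    -- once the latter takes values in `D`.
    exact ⟨h3, hinj h1 (hg w h3).1 (h2'.trans (hg w h3).2.symm)⟩
  refine ⟨isOpen_iff_mem_nhds.2 ?_, g, fun v hv => ?_, ?_⟩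
  · rintro _ ⟨v, hv, rfl⟩
    obtain ⟨k, -, hk⟩ := hloc v hv
    exact hk.mono fun w hw => hw.1
  · have h := hg (f v) ⟨v, hv, rfl⟩
    exact hinj h.1 hv h.2
  · rintro _ ⟨v, hv, rfl⟩
    obtain ⟨k, hk, hkg⟩ := hloc v hv
    exact (hk.congr_of_eventuallyEq (hkg.mono fun w hw => hw.2.symm)).contMDiffWithinAt

/-- The cotangent lift of a diffeomorphism `f : D → f(D)` maps the set of covectors generated by a
function on a constraint set to the one generated by the transported function on the transported
constraint set. -/
theorem cotangentLift_image_constrainedDifferential {f : M → M'} {g : M' → M} {D : Set M}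
    (hD : IsOpen D) (hfD : IsOpen (f '' D)) (hf : ContMDiffOn I I' ∞ f D)
    (hg : ContMDiffOn I' I ∞ g (f '' D)) (hgf : LeftInvOn g f D) (K : Set M') {L : M → ℝ}
    (hL : ContMDiff I 𝓘(ℝ, ℝ) ∞ L) :
    cotangentLift I I' f '' constrainedDifferential I {v | v ∈ D ∧ f v ∈ K} L =
      constrainedDifferential I' (K ∩ f '' D) (L ∘ g) := by
  have n0 : (∞ : ℕ∞ω) ≠ 0 := by simp
  have df : ∀ v ∈ D, ContMDiffAt I I' ∞ f v := fun v hv => hf.contMDiffAt (hD.mem_nhds hv)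
  have dg : ∀ v ∈ D, ContMDiffAt I' I ∞ g (f v) := fun v hv =>
    hg.contMDiffAt (hfD.mem_nhds (mem_image_of_mem f hv))
  have egf : ∀ v ∈ D, ∀ᶠ u in 𝓝 v, g (f u) = u := fun v hv =>
    Filter.mem_of_superset (hD.mem_nhds hv) fun u hu => hgf hu
  have efg : ∀ v ∈ D, ∀ᶠ w in 𝓝 (f v), f (g w) = w := fun v hv => by
    filter_upwards [hfD.mem_nhds (mem_image_of_mem f hv)]
    rintro _ ⟨u, hu, rfl⟩
    rw [hgf hu]
  let T : M → E →L[ℝ] E' := fun v => mfderiv I I' f v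
  let T' : M → E' →L[ℝ] E := fun v => mfderiv I' I g (f v)
  let dL : M → E →L[ℝ] ℝ := fun v => differential I L v
  let dL' : M' → E' →L[ℝ] ℝ := fun w => differential I' (L ∘ g) w
  have hT' : ∀ v ∈ D, ∀ X, T' v (T v X) = X := fun v hv X =>
    mfderiv_leftInverse_apply ((df v hv).mdifferentiableAt n0)
      ((dg v hv).mdifferentiableAt n0) (egf v hv) X
  have hT : ∀ v ∈ D, ∀ Y, T v (T' v Y) = Y := fun v hv Y => by
    have h := mfderiv_leftInverse_apply ((dg v hv).mdifferentiableAt n0)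
      (by rw [hgf hv]; exact (df v hv).mdifferentiableAt n0) (efg v hv) Y
    rwa [hgf hv] at h
  -- The total operation `inverse` is the true inverse here, since `Df` and `Dg` are mutually
  -- inverse over `D`.
  have hinv : ∀ v ∈ D, (T v).inverse = T' v := fun v hv =>
    ContinuousLinearMap.inverse_eq (ContinuousLinearMap.ext (hT v hv))
      (ContinuousLinearMap.ext (hT' v hv))
  have htan : ∀ v ∈ D, ∀ X : E, T v X ∈ submanifoldTangent I' (K ∩ f '' D) (f v) ↔
      X ∈ submanifoldTangent I {v | v ∈ D ∧ f v ∈ K} v := fun v hv X =>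
    mfderiv_mem_submanifoldTangent_iff (S := {v | v ∈ D ∧ f v ∈ K}) (S' := K ∩ f '' D)
      (df v hv) (dg v hv) (egf v hv)
      (Filter.Eventually.of_forall fun u hu => ⟨hu.2, u, hu.1, rfl⟩)
      (Filter.Eventually.of_forall fun w hw => by
        obtain ⟨hwK, u, hu, rfl⟩ := hw
        rw [hgf hu]
        exact ⟨hu, hwK⟩)
  have hdL : ∀ v ∈ D, ∀ Y, dL' (f v) Y = dL v (T' v Y) := fun v hv Y =>
    mfderiv_comp_apply_of_eq' (hL.mdifferentiable n0 v) ((dg v hv).mdifferentiableAt n0)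
      (hgf hv) Y
  ext ν
  constructor
  · rintro ⟨⟨v, μ : E →L[ℝ] ℝ⟩, ⟨⟨hv, hvK⟩, hμ⟩, rfl⟩
    change v ∈ D at hv
    refine ⟨⟨hvK, v, hv, rfl⟩, fun Y hY => ?_⟩
    obtain ⟨X, rfl⟩ : ∃ X, T v X = Y := ⟨_, hT v hv Y⟩
    have h1 : μ X - dL v X = 0 := hμ X ((htan v hv X).1 hY)
    change μ ((T v).inverse (T v X)) - dL' (f v) (T v X) = 0
    rw [hinv v hv, hdL v hv, hT' v hv, h1]
  · rcases ν with ⟨w, ν⟩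
    rintro ⟨⟨hwK, v, hv, hvw⟩, hν⟩
    change f v = w at hvw
    subst hvw
    change E' →L[ℝ] ℝ at ν
    refine ⟨⟨v, ν ∘L T v⟩, ⟨⟨hv, hwK⟩, fun X hX => ?_⟩, ?_⟩
    · change E at X
      have h1 : ν (T v X) - dL' (f v) (T v X) = 0 := hν _ ((htan v hv X).2 hX)
      rw [hdL v hv, hT' v hv] at h1
      exact h1
    · refine congrArg (fun ν' : E' →L[ℝ] ℝ => (⟨f v, ν'⟩ : CotangentBundle I' M')) ?_
      refine ContinuousLinearMap.ext fun Y => ?_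
      change E' at Y
      change ν (T v ((T v).inverse Y)) = ν Y
      rw [hinv v hv, hT v hv]

end Transport

/-! ### Pulling generated relations back to `N × N`. -/

section PullbackPairs

variable {E F : Type*} [NormedAddCommGroup E] [NormedSpace ℝ E]
  [NormedAddCommGroup F] [NormedSpace ℝ F]
  {Q : Type*} [TopologicalSpace Q] [ChartedSpace E Q] [IsManifold 𝓘(ℝ, E) ∞ Q]
  {N : Type*} [TopologicalSpace N] [ChartedSpace F N] [IsManifold 𝓘(ℝ, F) ∞ N]

/-- The pull-back to `T*N × T*N` of the relation generated by `ℓ` along `i(N) × i(N)` is the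
relation generated by `ℓ ∘ (i × i)`. -/
theorem pullbackPairs_generated {i : N → Q}
    (hi : Manifold.IsSmoothEmbedding 𝓘(ℝ, F) 𝓘(ℝ, E) ∞ i) {W : Set (Q × Q)} (hW : IsOpen W)
    {ℓ : Q × Q → ℝ} (hℓ : ContMDiffOn (𝓘(ℝ, E).prod 𝓘(ℝ, E)) 𝓘(ℝ, ℝ) ∞ ℓ W) :
    pullbackPairs 𝓘(ℝ, F) 𝓘(ℝ, E) i (productCovector 𝓘(ℝ, E) Q ⁻¹'
        constrainedDifferential (𝓘(ℝ, E).prod 𝓘(ℝ, E)) ((range i ×ˢ range i) ∩ W) ℓ) =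
      productCovector 𝓘(ℝ, F) N ⁻¹' constrainedDifferential (𝓘(ℝ, F).prod 𝓘(ℝ, F))
        (Prod.map i i ⁻¹' W) (ℓ ∘ Prod.map i i) := by
  have n0 : (∞ : ℕ∞ω) ≠ 0 := by simp
  have hj : Manifold.IsSmoothEmbedding (𝓘(ℝ, F).prod 𝓘(ℝ, F)) (𝓘(ℝ, E).prod 𝓘(ℝ, E)) ∞
    (Prod.map i i) := hi.prodMap hi
  -- On `N × N` the constraint of lying in `i N × i N` is vacuous; only the open condition survives.
  have hrange : (Prod.map i i ⁻¹' ((range i ×ˢ range i) ∩ W)) = Prod.map i i ⁻¹' W := by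
    ext x
    exact ⟨fun h => h.2, fun h => ⟨⟨⟨x.1, rfl⟩, ⟨x.2, rfl⟩⟩, h⟩⟩
  have di : ∀ x, MDifferentiableAt 𝓘(ℝ, F) 𝓘(ℝ, E) i x := fun x =>
    hi.contMDiff.mdifferentiable n0 x
  let T : N → F →L[ℝ] E := fun x => mfderiv 𝓘(ℝ, F) 𝓘(ℝ, E) i x
  have hdj : ∀ (x : N × N) (X : F × F),
      (mfderiv (𝓘(ℝ, F).prod 𝓘(ℝ, F)) (𝓘(ℝ, E).prod 𝓘(ℝ, E)) (Prod.map i i) x X : E × E) =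
        (T x.1 X.1, T x.2 X.2) := fun x X =>
    congrArg (fun A : F × F →L[ℝ] E × E => A X) (mfderiv_prodMap (di x.1) (di x.2))
  let dℓ : Q × Q → E × E →L[ℝ] ℝ := fun q => differential (𝓘(ℝ, E).prod 𝓘(ℝ, E)) ℓ q
  let dℓ' : N × N → F × F →L[ℝ] ℝ := fun x =>
    differential (𝓘(ℝ, F).prod 𝓘(ℝ, F)) (ℓ ∘ Prod.map i i) x
  have hdℓ : ∀ x : N × N, Prod.map i i x ∈ W → ∀ X : F × F,
      dℓ' x X = dℓ (Prod.map i i x) (T x.1 X.1, T x.2 X.2) := fun x hx X => by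
    rw [← hdj]
    exact mfderiv_comp_apply_of_eq' ((hℓ.contMDiffAt (hW.mem_nhds hx)).mdifferentiableAt n0)
      (hj.contMDiff.mdifferentiable n0 x) rfl X
  ext b
  constructor
  · rintro ⟨x₀, x₁, (p₀ : E →L[ℝ] ℝ), (p₁ : E →L[ℝ] ℝ), ⟨⟨-, hxW⟩, hp⟩, rfl⟩
    refine ⟨hxW, fun X hX => ?_⟩
    change F × F at X
    have h1 := mfderiv_mem_submanifoldTangent
      (S' := (range i ×ˢ range i) ∩ W) (hj.contMDiff.contMDiffAt (x := (x₀, x₁)))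
      (Filter.Eventually.of_forall fun y hy => hrange.superset hy) hX
    have h2 : ((-p₀).coprod p₁ - dℓ (Prod.map i i (x₀, x₁))) (mfderiv (𝓘(ℝ, F).prod 𝓘(ℝ, F))
      (𝓘(ℝ, E).prod 𝓘(ℝ, E)) (Prod.map i i) (x₀, x₁) X : E × E) = 0 := hp _ h1
    rw [hdj (x₀, x₁) X] at h2
    change (-p₀).coprod p₁ (T x₀ X.1, T x₁ X.2) -
      dℓ (Prod.map i i (x₀, x₁)) (T x₀ X.1, T x₁ X.2) = 0 at h2
    change (-(p₀ ∘L T x₀)).coprod (p₁ ∘L T x₁) X - dℓ' (x₀, x₁) X = 0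
    rw [hdℓ (x₀, x₁) hxW X, ← h2]
    rfl
  · rcases b with ⟨⟨x₀, r₀⟩, ⟨x₁, r₁⟩⟩
    rintro ⟨hxW, hr⟩
    change F →L[ℝ] ℝ at r₀ r₁
    -- Covectors of `N` extend to `Q` by composition with a linear left inverse of `T_x i`. The
    -- choice is immaterial: `T C` comes entirely from `N × N`, so the annihilation condition sees
    -- only the restriction.
    have hleft : ∀ x : N, ∃ P : E →L[ℝ] F, ∀ a, P (T x a) = a := fun x => by
      obtain ⟨ρ, hρ, hρi⟩ := (hi.isImmersion.isImmersionAt x).exists_leftInverse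
      exact ⟨mfderiv 𝓘(ℝ, E) 𝓘(ℝ, F) ρ (i x), fun a =>
        mfderiv_leftInverse_apply (di x) (hρ.mdifferentiableAt n0) hρi a⟩
    obtain ⟨P₀, hP₀⟩ := hleft x₀
    obtain ⟨P₁, hP₁⟩ := hleft x₁
    refine ⟨x₀, x₁, r₀ ∘L P₀, r₁ ∘L P₁,
      ⟨⟨⟨⟨x₀, rfl⟩, ⟨x₁, rfl⟩⟩, hxW⟩, fun Y hY => ?_⟩, ?_⟩
    · obtain ⟨X, hX, rfl⟩ := hj.exists_mfderiv_eq (x := (x₀, x₁))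
        (by rw [Set.range_prodMap]; exact inter_subset_left) hY
      rw [hrange] at hX
      change F × F at X
      have h1 : (-r₀).coprod r₁ X - dℓ' (x₀, x₁) X = 0 := hr X hX
      rw [hdℓ (x₀, x₁) hxW X] at h1
      change ((-(r₀ ∘L P₀)).coprod (r₁ ∘L P₁) - dℓ (Prod.map i i (x₀, x₁)))
        (mfderiv (𝓘(ℝ, F).prod 𝓘(ℝ, F)) (𝓘(ℝ, E).prod 𝓘(ℝ, E)) (Prod.map i i) (x₀, x₁) X : E × E)
        = 0
      rw [hdj (x₀, x₁) X, ← h1]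
      change -r₀ (P₀ (T x₀ X.1)) + r₁ (P₁ (T x₁ X.2)) - _ = -r₀ X.1 + r₁ X.2 - _
      rw [hP₀, hP₁]
      rfl
    · refine congrArg₂ (fun s₀ s₁ : F →L[ℝ] ℝ => (((⟨x₀, s₀⟩, ⟨x₁, s₁⟩) :
        CotangentBundle 𝓘(ℝ, F) N × CotangentBundle 𝓘(ℝ, F) N))) ?_ ?_
      · exact ContinuousLinearMap.ext fun a => (congrArg r₀ (hP₀ a)).symm
      · exact ContinuousLinearMap.ext fun a => (congrArg r₁ (hP₁ a)).symm

end PullbackPairs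

/-! ### The three assertions for the discretized dynamics. -/

theorem mainTheorem2
    {E F : Type*} [NormedAddCommGroup E] [NormedSpace ℝ E] [FiniteDimensional ℝ E]
    [NormedAddCommGroup F] [NormedSpace ℝ F] [FiniteDimensional ℝ F]
    {Q : Type*} [TopologicalSpace Q] [ChartedSpace E Q] [IsManifold 𝓘(ℝ, E) ∞ Q]
    {N : Type*} [TopologicalSpace N] [ChartedSpace F N] [IsManifold 𝓘(ℝ, F) ∞ N]
    (i : N → Q) (hi : Manifold.IsSmoothEmbedding 𝓘(ℝ, F) 𝓘(ℝ, E) ∞ i)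
    (U : Set (TangentBundle 𝓘(ℝ, E) Q)) (R : TangentBundle 𝓘(ℝ, E) Q → Q × Q)
    (hR : IsDiscretizationMap 𝓘(ℝ, E) U R)
    (h : ℝ) (hh : 0 < h)
    (D : Set (TangentBundle 𝓘(ℝ, E) Q)) (hDU : ∀ v ∈ D, fiberScale 𝓘(ℝ, E) h v ∈ U)
    (hDopen : IsOpen D)
    (hDinj : InjOn (scaledMap 𝓘(ℝ, E) R h) D)
    (hDdiff : IsLocalDiffeomorphOn 𝓘(ℝ, E).tangent (𝓘(ℝ, E).prod 𝓘(ℝ, E)) ∞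
      (scaledMap 𝓘(ℝ, E) R h) D)
    (Lt : TangentBundle 𝓘(ℝ, E) Q → ℝ) (hLt : ContMDiff 𝓘(ℝ, E).tangent 𝓘(ℝ, ℝ) ∞ Lt)
    (A : Set (CotangentBundle 𝓘(ℝ, E) Q × CotangentBundle 𝓘(ℝ, E) Q))
    (hA : A = discretizationLift 𝓘(ℝ, E) (scaledMap 𝓘(ℝ, E) R h) ''
      modifiedDynamics 𝓘(ℝ, E) i D (scaledMap 𝓘(ℝ, E) R h) Lt) :
    IsLagrangianSubmanifold (differenceForm 𝓘(ℝ, E) Q) A ∧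
    (fun a : CotangentBundle 𝓘(ℝ, E) Q × CotangentBundle 𝓘(ℝ, E) Q => (a.1.proj, a.2.proj)) '' A =
      (range i ×ˢ range i) ∩ scaledMap 𝓘(ℝ, E) R h '' D ∧
    IsLagrangianSubmanifold (differenceForm 𝓘(ℝ, F) N)
      (pullbackPairs 𝓘(ℝ, F) 𝓘(ℝ, E) i A) := by
  set f := scaledMap 𝓘(ℝ, E) R h
  -- The zero vectors are dummy values for the inverse outside `f '' D`.
  obtain ⟨hW, g, hgf, hg⟩ := hDdiff.exists_inverse (fun q => ⟨q.1, 0⟩) hDopen hDinj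
  have hA' : A = productCovector 𝓘(ℝ, E) Q ⁻¹'
      constrainedDifferential (𝓘(ℝ, E).prod 𝓘(ℝ, E)) ((range i ×ˢ range i) ∩ f '' D) (Lt ∘ g) := by
    rw [hA, ← cotangentLift_image_constrainedDifferential hDopen hW hDdiff.contMDiffOn hg hgf
      (range i ×ˢ range i) hLt, ← Equiv.image_symm_eq_preimage]
    unfold discretizationLift modifiedDynamics
    rw [← Set.image_image (productCovector 𝓘(ℝ, E) Q).symm, ← Set.image_image
      (cotangentLift 𝓘(ℝ, E).tangent (𝓘(ℝ, E).prod 𝓘(ℝ, E)) f),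
      Set.image_preimage_eq _ (tulczyjew 𝓘(ℝ, E) Q).surjective]
    rfl
  have hℓ : ContMDiffOn (𝓘(ℝ, E).prod 𝓘(ℝ, E)) 𝓘(ℝ, ℝ) ∞ (Lt ∘ g) (f '' D) :=
    hLt.comp_contMDiffOn hg
  have hj := hi.prodMap hi
  have hC : IsEmbeddedSubmanifold (𝓘(ℝ, E).prod 𝓘(ℝ, E)) ((range i ×ˢ range i) ∩ f '' D) := by
    rw [← Set.range_prodMap]
    exact hj.isEmbeddedSubmanifold_range.inter_isOpen hW
  have hWN : IsOpen (Prod.map i i ⁻¹' (f '' D)) := hW.preimage hj.contMDiff.continuous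
  refine ⟨?_, ?_, ?_⟩
  · rw [hA']
    exact isLagrangianSubmanifold_generated hC hW inter_subset_right hℓ
  · rw [hA']
    ext c
    constructor
    · rintro ⟨a, ha, rfl⟩
      exact ha.1
    · intro hc
      -- Over each `c` the covector `dℓ(c)` itself is admissible, its difference with `dℓ(c)` being
      -- zero.
      refine ⟨(productCovector 𝓘(ℝ, E) Q).symm
        ⟨c, differential (𝓘(ℝ, E).prod 𝓘(ℝ, E)) (Lt ∘ g) c⟩, ?_, rfl⟩
      rw [mem_preimage, Equiv.apply_symm_apply]
      refine ⟨hc, fun X _ => ?_⟩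
      simp
  · rw [hA', pullbackPairs_generated hi hW hℓ]
    exact isLagrangianSubmanifold_generated hWN.isEmbeddedSubmanifold hWN subset_rfl
      (hℓ.comp hj.contMDiff.contMDiffOn subset_rfl)
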